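/- **Conventions.** Let $P$ be a finite graded poset with minimum $\hat 0$, rank function $r(\cdot)$ with $r(\hat 0)=0$, and rank $r=\max_{t\in P} r(t)$. The toric polynomials are defined recursively by $f(\emptyset,x)=g(\emptyset,x)=1$, $$f(P,x)=\sum_{t\in P} g([\hat 0,t),x)\,(x-1)^{r-r(t)},\qquad [\hat 0,t)=\{z\in P: z<t\},$$ and, writing $f(P,x)=h_0+h_1x+\cdots$, $$g(P,x)=h_0+\sum_{i=1}^{\lfloor r/2\rfloor}(h_i-h_{i-1})x^i ;$$ $g_1(P)$ is the coefficient of $x$ in $g(P,x)$. Let $\hat P=P\cup\{\hat 1\}$ be $P$ with a new maximum. For an ideal (lower set) $I$ of $P$, the Bier poset $\mathrm{Bier}(P,I)$ is the set of all intervals $[x,y]$ with $x\in I$ and $y\in\hat P\setminus I$, ordered by reverse inclusion. $X^*$ denotes the opposite of the poset $X$. For $n\ge d\ge 2$, a multiplex $M^{d,n}$ is a $d$-dimensional convex polytope with $n+1$ vertices $x_0,\dots,x_n$ whose facets are exactly $$F_i=\mathrm{conv}(x_{i-d+1},\dots,x_{i-1},x_{i+1},\dots,x_{i+d-1}),\qquad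 0\le i\le n,$$ where $x_j=x_0$ for $j<0$ and $x_j=x_n$ for $j>n$. Its boundary poset is the set of its proper faces, including the empty face, ordered by inclusion. **Lemma.** Let $n\ge d\ge 4$, let $M$ be the boundary poset of a multiplex $M^{d,n}$, let $I\neq\{\hat 0\}$ be an ideal of $M$, and let $t$ be a maximal element of $I$. Put $A=(t,\hat 1]^*$ (where $(t,\hat 1]=\{y\in\hat M: t<y\}$), $B=[\hat 0,t)$ and $$\Delta g=g(\mathrm{Bier}(M,I\setminus\{t\}),x)-g(\mathrm{Bier}(M,I),x).$$ 1. If $d>r(t)>\lceil d/2\rceil+1$, then $$\Delta g=g_1(A)\,x^{d-r(t)}+\bigl(g_1(B)g_1(A)+1\bigr)x^{d-r(t)+1}+g_1(B)\,x^{d-r(t)+2}.$$ 2. If $r(t)=d$ (that is, $t$ is a facet), then $\Delta g=x+g_1(B)\,x^2$. In both cases all coefficients of $\Delta g$ are nonnegative. -/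

import Mathlib

open Polynomial

/-- The rank `r(t)` of an element of a graded poset with minimum: the length of the longest
chain that ends in `t`. -/
noncomputable def elemRank {P : Type*} [PartialOrder P] (t : P) : ℕ :=
  (Order.height t).toNat

/-- The rank of a finite graded poset with minimum: the largest rank of an element. -/
noncomputable def posetRank (P : Type*) [PartialOrder P] : ℕ :=
  ⨆ t : P, elemRank t

/-- For `f = h₀ + h₁ x + ⋯`, the polynomial
`h₀ + (h₁ - h₀) x + ⋯ + (h_{⌊r/2⌋} - h_{⌊r/2⌋-1}) x^⌊r/2⌋`. -/
noncomputable def gTrunc (r : ℕ) (f : ℤ[X]) : ℤ[X] :=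
  C (f.coeff 0) + ∑ i ∈ Finset.Icc 1 (r / 2), C (f.coeff i - f.coeff (i - 1)) * X ^ i

open Classical in
/-- The toric polynomial `f(P, x)`, by recursion on the number of elements:
`f(∅, x) = 1` and `f(P, x) = ∑_{t ∈ P} g([0̂, t), x) (x - 1)^{r - r(t)}`. -/
noncomputable def toricF (P : Type*) [PartialOrder P] [Finite P] : ℤ[X] :=
  if IsEmpty P then 1 else
    ∑ᶠ t : P, gTrunc (posetRank (Set.Iio t)) (toricF (Set.Iio t)) *
      (X - 1) ^ (posetRank P - elemRank t)
termination_by Nat.card P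
decreasing_by
  rw [← Set.ncard_univ P, Nat.card_coe_set_eq]
  refine Set.ncard_lt_ncard (Set.ssubset_univ_iff.2 fun h => ?_) (Set.toFinite _)
  exact lt_irrefl t (h ▸ Set.mem_univ t : t ∈ Set.Iio t)

/-- The toric polynomial `g(P, x)`; for the empty poset it equals `1`. -/
noncomputable def toricG (P : Type*) [PartialOrder P] [Finite P] : ℤ[X] :=
  gTrunc (posetRank P) (toricF P)

/-- The Bier poset of `P` and an ideal (lower set) `I` of `P`: all intervals `[x, y]` of
`P̂ = P ∪ {1̂}` with `x ∈ I` and `y ∈ P̂ - I`, ordered by reverse inclusion. -/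
abbrev Bier (P : Type*) [PartialOrder P] (I : Set P) : Type _ :=
  {s : (NonemptyInterval (WithTop P))ᵒᵈ //
    (OrderDual.ofDual s).fst ∈ ((↑) : P → WithTop P) '' I ∧
      (OrderDual.ofDual s).snd ∉ ((↑) : P → WithTop P) '' I}

instance nonemptyIntervalFinite (P : Type*) [PartialOrder P] [Finite P] :
    Finite (NonemptyInterval P) :=
  Finite.of_injective NonemptyInterval.toProd NonemptyInterval.toProd_injective

/-- The boundary poset of a convex polytope `K`: its proper faces (the empty face included),
ordered by inclusion. -/
abbrev BoundaryPoset {E : Type*} [NormedAddCommGroup E] [NormedSpace ℝ E] (K : Set E) : Type _ :=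
  {F : Set E // IsExposed ℝ K F ∧ F ≠ K}

/-- A polytope has finitely many faces. -/
instance boundaryPosetFinite {E ι : Type*} [NormedAddCommGroup E] [NormedSpace ℝ E] [Finite ι]
    (x : ι → E) : Finite (BoundaryPoset (convexHull ℝ (Set.range x))) := by
  have hK : IsCompact (convexHull ℝ (Set.range x)) := (Set.finite_range x).isCompact_convexHull ℝ
  have hfin : Finite {S : Set E // S ⊆ Set.range x} :=
    (Set.finite_range x).finite_subsets.to_subtype
  refine Finite.of_injective
    (β := {S : Set E // S ⊆ Set.range x})
    (fun F => ⟨F.1.extremePoints ℝ, ?_⟩) ?_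
  · rw [F.2.1.isExtreme.extremePoints_eq]
    exact Set.inter_subset_right.trans extremePoints_convexHull_subset
  · intro F G h
    have h' : F.1.extremePoints ℝ = G.1.extremePoints ℝ := congrArg Subtype.val h
    apply Subtype.ext
    rw [← closure_convexHull_extremePoints (F.2.1.isCompact hK)
        (F.2.1.convex (convex_convexHull ℝ _)), h',
      closure_convexHull_extremePoints (G.2.1.isCompact hK)
        (G.2.1.convex (convex_convexHull ℝ _))]

/-- `F` is a facet of the polytope `K`: a face of dimension `dim K - 1`. -/
def IsFacet {E : Type*} [NormedAddCommGroup E] [NormedSpace ℝ E] (K F : Set E) : Prop :=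
  IsExposed ℝ K F ∧ F.Nonempty ∧
    Module.finrank ℝ (vectorSpan ℝ F) + 1 = Module.finrank ℝ (vectorSpan ℝ K)

/-- The indices of the list `x_{i-d+1}, …, x_{i-1}, x_{i+1}, …, x_{i+d-1}`, where `x_j` means
`x_0` for `j < 0` and `x_n` for `j > n`. -/
def multiplexFacet (d n : ℕ) (i : Fin (n + 1)) : Set (Fin (n + 1)) :=
  {j | ∃ k : ℤ, 1 ≤ |k| ∧ |k| ≤ (d : ℤ) - 1 ∧ (j : ℤ) = max 0 (min (n : ℤ) ((i : ℤ) + k))}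

/-- The points `x_0, …, x_n` are the vertices, in this order, of a multiplex `M^{d,n}`: their
convex hull is a `d`-dimensional polytope with vertices `x_0, …, x_n`, whose facets are exactly
`conv(x_{i-d+1}, …, x_{i-1}, x_{i+1}, …, x_{i+d-1})` for `0 ≤ i ≤ n`. -/
structure IsMultiplex (d n : ℕ) (x : Fin (n + 1) → EuclideanSpace ℝ (Fin d)) : Prop where
  convexIndependent : ConvexIndependent ℝ x
  affineSpan_eq_top : affineSpan ℝ (Set.range x) = ⊤
  facets : ∀ F : Set (EuclideanSpace ℝ (Fin d)),
    IsFacet (convexHull ℝ (Set.range x)) F ↔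
      ∃ i : Fin (n + 1), F = convexHull ℝ (x '' multiplexFacet d n i)

/-! Let ρ be the rank and γ_t = g([0̂,t)). In the posets at hand Σ_{u ≤ t} γ_u (x-1)^(ρ(t)-ρ(u)) is
the reversal x^ρ(t) γ_t(1/x). Together with deg γ_t < ρ(t)/2 for ρ(t) > 0 and γ_t = 1 for ρ(t) = 0,
this identity determines γ (`IsToricData.toricG_Iio`), and it is multiplicative over products
(`IsToricData.prod`). A Bier poset is a lower set in the product of P̂ with its opposite, so its
lower intervals have product g-polynomials. Deleting t from I trades the intervals [t,y], y > t, for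
the intervals [x,t], x < t. Summing both families by the identity shows that Δg is the truncation of
f, where (1-x)f = γ_t δ' - δ_t γ'; here δ_t = g((t,1̂]*), and γ', δ' are the reversals of γ_t, δ_t
(`IsToricData.toricG_bier_diff`).

For a multiplex all these polynomials are linear. Every nonempty proper face is an intersection of
facets (`IsExposed.exists_isFacet`), so the face lattice is the lattice of closed sets of the
vertex-facet incidence `Rel`. This relation is symmetric, hence the lattice is self-dual. With e(V)
= max(0, max V - min V - d), a face with vertex set V has rank |V| - e(V) and γ = 1 + e(V)x; the
identity is proved by induction on the number of vertices (`Multiplex.IsFlat.sum_eq`).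

Substitution turns (1-x)f into a difference of two trinomials, one in degrees at most d/2 and the
other in degrees above. Truncation keeps the first. Its coefficients are nonnegative because g₁(A)
and g₁(B) are values of e. For a facet t the dual face has rank 1, so g₁(A) = 0. -/

/-! ### Toric polynomials from a recursion on principal lower intervals -/

/-- A rank function `ρ` and polynomials `γ` on a poset which satisfy the recursion that
characterizes the toric `g`-polynomials of its principal lower intervals. -/
structure IsToricData {P : Type*} [PartialOrder P] (ρ : P → ℕ) (γ : P → ℤ[X]) : Prop where
  strictMono : StrictMono ρ
  exists_lt : ∀ t, ρ t ≠ 0 → ∃ u < t, ρ u + 1 = ρ t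
  eq_one : ∀ t, ρ t = 0 → γ t = 1
  coeff_eq_zero : ∀ t k, 0 < k → ρ t ≤ 2 * k → (γ t).coeff k = 0
  sum_eq : ∀ t, ∑ᶠ u ∈ Set.Iic t, γ u * (X - 1) ^ (ρ t - ρ u) = reflect (ρ t) (γ t)

theorem coeff_gTrunc (r : ℕ) (f : ℤ[X]) (i : ℕ) :
    (gTrunc r f).coeff i = if i ≤ r / 2 then ((1 - X) * f).coeff i else 0 := by
  have h : ((1 - X) * f) = f - X * f := by ring
  rw [gTrunc, h, coeff_add, finsetSum_coeff]
  simp only [coeff_C_mul_X_pow, coeff_C]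
  rw [Finset.sum_ite_eq]
  rcases i with _ | i
  · simp
  · simp [coeff_X_mul]

/-- By `coeff_gTrunc`, truncation cuts (1-x)f off after degree r/2, so only the low part survives.
In the applications `h` is the reversal of `g` and starts above the middle. -/
theorem gTrunc_eq_of_mul_eq (r : ℕ) (f g h : ℤ[X]) (hf : (1 - X) * f = g - h)
    (hg : ∀ k, r / 2 < k → g.coeff k = 0) (hh : ∀ k, k ≤ r / 2 → h.coeff k = 0) :
    gTrunc r f = g := by
  ext k
  rw [coeff_gTrunc, hf, coeff_sub]
  split_ifs with hk
  · rw [hh k hk, sub_zero]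
  · rw [hg k (by omega)]

theorem gTrunc_add (r : ℕ) (f g : ℤ[X]) : gTrunc r (f + g) = gTrunc r f + gTrunc r g := by
  ext k
  simp only [coeff_gTrunc, coeff_add, mul_add]
  split_ifs <;> simp

theorem gTrunc_sub (r : ℕ) (f g : ℤ[X]) : gTrunc r (f - g) = gTrunc r f - gTrunc r g := by
  rw [eq_sub_iff_add_eq, ← gTrunc_add, sub_add_cancel]

theorem coeff_reflect_of_le {N k : ℕ} (f : ℤ[X]) (h : k ≤ N) :
    (reflect N f).coeff k = f.coeff (N - k) := by
  rw [coeff_reflect, revAt_le h]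

theorem elemRank_eq_of_strictMono {P : Type*} [PartialOrder P] {ρ : P → ℕ} (hs : StrictMono ρ)
    (he : ∀ t, ρ t ≠ 0 → ∃ u < t, ρ u + 1 = ρ t) (t : P) : elemRank t = ρ t := by
  suffices h : ∀ N : ℕ, ∀ t, ρ t = N → Order.height t = N by
    rw [elemRank, h _ t rfl]; rfl
  intro N
  induction N using Nat.strong_induction_on with
  | _ N ih =>
    intro t ht
    refine le_antisymm ?_ ?_
    · rw [Order.height_le_coe_iff]
      intro y hy
      have := hs hy
      rw [ih (ρ y) (by omega) y rfl]
      exact_mod_cast (by omega)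
    · rcases Nat.eq_zero_or_pos N with h0 | h0
      · simp [h0]
      · obtain ⟨u, hu, hu'⟩ := he t (by omega)
        have := Order.height_add_one_le hu
        rw [ih (ρ u) (by omega) u rfl] at this
        have h2 : (N : ℕ∞) = (ρ u : ℕ∞) + 1 := by rw [← ht, ← hu']; push_cast; rfl
        rw [h2]; exact this

namespace IsToricData

variable {P Q : Type*} [PartialOrder P] [PartialOrder Q] {ρ : P → ℕ} {γ : P → ℤ[X]}

theorem elemRank_eq (h : IsToricData ρ γ) (t : P) : elemRank t = ρ t :=
  elemRank_eq_of_strictMono h.strictMono h.exists_lt t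

/-- Each condition at an element involves only what lies below it, and a lower set retains all of
that. -/
theorem comap (h : IsToricData ρ γ) (e : Q ↪o P) (he : IsLowerSet (Set.range e)) :
    IsToricData (ρ ∘ e) (γ ∘ e) where
  strictMono := h.strictMono.comp e.strictMono
  exists_lt t ht := by
    obtain ⟨u, hu, hu'⟩ := h.exists_lt (e t) ht
    obtain ⟨v, rfl⟩ := he hu.le ⟨t, rfl⟩
    exact ⟨v, e.lt_iff_lt.1 hu, hu'⟩
  eq_one t ht := h.eq_one _ ht
  coeff_eq_zero t := h.coeff_eq_zero _
  sum_eq t := by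
    refine Eq.trans ?_ (h.sum_eq (e t))
    refine finsum_mem_eq_of_bijOn e ⟨fun u hu => e.monotone hu, e.injective.injOn, ?_⟩
      (fun u _ => rfl)
    intro u hu
    obtain ⟨v, rfl⟩ := he hu ⟨t, rfl⟩
    exact ⟨v, e.le_iff_le.1 hu, rfl⟩

theorem natDegree_le (h : IsToricData ρ γ) (t : P) : (γ t).natDegree ≤ ρ t := by
  rw [natDegree_le_iff_coeff_eq_zero]
  intro k hk
  exact h.coeff_eq_zero t k (by omega) (by omega)

/-- Ranks add, so the degree bound by half the rank and the reversal of coefficients both respect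
products, and the sum over a lower interval factors. -/
theorem prod [Finite P] [Finite Q] {ρ' : Q → ℕ} {γ' : Q → ℤ[X]} (h : IsToricData ρ γ)
    (h' : IsToricData ρ' γ') :
    IsToricData (fun p : P × Q => ρ p.1 + ρ' p.2) (fun p => γ p.1 * γ' p.2) where
  strictMono := by
    intro a b hab
    have h1 := h.strictMono.monotone hab.le.1
    have h2 := h'.strictMono.monotone hab.le.2
    rcases Prod.lt_iff.1 hab with ⟨h3, _⟩ | ⟨_, h3⟩
    · have := h.strictMono h3
      dsimp only; omega
    · have := h'.strictMono h3
      dsimp only; omega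
  exists_lt := by
    rintro ⟨a, b⟩ hab
    dsimp only at hab ⊢
    by_cases ha : ρ a = 0
    · obtain ⟨v, hv, hv'⟩ := h'.exists_lt b (by omega)
      exact ⟨(a, v), Prod.mk_lt_mk_iff_right.2 hv, by dsimp only; omega⟩
    · obtain ⟨u, hu, hu'⟩ := h.exists_lt a ha
      exact ⟨(u, b), Prod.mk_lt_mk_iff_left.2 hu, by dsimp only; omega⟩
  eq_one := by
    rintro ⟨a, b⟩ hab
    dsimp only at hab ⊢
    rw [h.eq_one a (by omega), h'.eq_one b (by omega), one_mul]
  coeff_eq_zero := by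
    rintro ⟨a, b⟩ k hk hab
    dsimp only at hab ⊢
    rw [coeff_mul]
    refine Finset.sum_eq_zero fun p hp => ?_
    rw [Finset.HasAntidiagonal.mem_antidiagonal] at hp
    by_cases h1 : 0 < p.1 ∧ ρ a ≤ 2 * p.1
    · rw [h.coeff_eq_zero a _ h1.1 h1.2, zero_mul]
    · rw [h'.coeff_eq_zero b p.2 (by omega) (by omega), mul_zero]
  sum_eq := by
    rintro ⟨a, b⟩
    dsimp only
    rw [reflect_mul _ _ (h.natDegree_le a) (h'.natDegree_le b), ← h.sum_eq, ← h'.sum_eq,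
      finsum_mem_eq_finite_toFinset_sum _ (Set.toFinite _),
      finsum_mem_eq_finite_toFinset_sum _ (Set.toFinite _),
      finsum_mem_eq_finite_toFinset_sum _ (Set.toFinite _), Finset.sum_mul_sum,
      ← Finset.sum_product']
    refine Finset.sum_congr ?_ ?_
    · ext ⟨u, v⟩; simp
    · rintro ⟨u, v⟩ huv
      simp only [Finset.mem_product, Set.Finite.mem_toFinset, Set.mem_Iic] at huv
      have h1 := h.strictMono.monotone huv.1
      have h2 := h'.strictMono.monotone huv.2
      have h3 : ρ a + ρ' b - (ρ u + ρ' v) = (ρ a - ρ u) + (ρ' b - ρ' v) := by omega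
      rw [h3, pow_add]
      ring

theorem sum_Iio_mul [Finite P] (h : IsToricData ρ γ) (t : P) :
    (X - 1) * ∑ᶠ u ∈ Set.Iio t, γ u * (X - 1) ^ (ρ t - 1 - ρ u) =
      reflect (ρ t) (γ t) - γ t := by
  rw [← h.sum_eq t, ← Set.Iio_insert,
    finsum_mem_insert _ (by simp) (Set.toFinite _), Nat.sub_self, pow_zero, mul_one,
    add_sub_cancel_left, finsum_mem_eq_finite_toFinset_sum _ (Set.toFinite _),
    finsum_mem_eq_finite_toFinset_sum _ (Set.toFinite _), Finset.mul_sum]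
  refine Finset.sum_congr rfl fun u hu => ?_
  have := h.strictMono (show u < t by simpa using hu)
  rw [show ρ t - ρ u = (ρ t - 1 - ρ u) + 1 by omega, pow_succ]
  ring

theorem posetRank_eq_of_range [Finite Q] (h : IsToricData ρ γ) (e : Q ↪o P) {t : P}
    (he : Set.range e = Set.Iio t) : posetRank Q = ρ t - 1 := by
  have hQ := h.comap e (he ▸ isLowerSet_Iio t)
  rcases isEmpty_or_nonempty Q with hE | hN
  · have h0 : ρ t = 0 := by
      by_contra h0
      obtain ⟨u, hu, -⟩ := h.exists_lt t h0
      obtain ⟨v, -⟩ : u ∈ Set.range e := he ▸ hu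
      exact hE.elim v
    -- The empty poset has rank 0, which the truncated difference `0 - 1` matches.
    simp [posetRank, h0]
  · have hlt : ∀ u : Q, ρ (e u) < ρ t := fun u =>
      h.strictMono (show e u ∈ Set.Iio t from he ▸ Set.mem_range_self u)
    refine le_antisymm (ciSup_le fun u => ?_) ?_
    · rw [hQ.elemRank_eq]
      have := hlt u
      simp only [Function.comp]; omega
    · obtain ⟨u0⟩ := hN
      have := hlt u0
      obtain ⟨u, hu, hu'⟩ := h.exists_lt t (by omega)
      obtain ⟨v, rfl⟩ : u ∈ Set.range e := he ▸ hu
      refine le_trans ?_ (le_ciSup (Set.finite_range _).bddAbove v)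
      rw [hQ.elemRank_eq]
      simp only [Function.comp]; omega

/-- Splitting off the term u = t leaves (1-x)f([0̂,t)) = γ t minus its reversal. The first is
supported up to degree (ρ t - 1)/2 and the second above it, so truncation returns γ t. A general `Q`
replaces `Set.Iio t` because the recursion produces intervals nested inside subtypes. -/
theorem toricG_eq_of_range_of_forall [Finite P] [Finite Q] (h : IsToricData ρ γ) (e : Q ↪o P) {t : P}
    (he : Set.range e = Set.Iio t) (hG : ∀ u : Q, toricG (Set.Iio u) = γ (e u)) :
    toricG Q = γ t := by
  have hQ := h.comap e (he ▸ isLowerSet_Iio t)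
  rcases isEmpty_or_nonempty Q with hE | hN
  · have h0 : ρ t = 0 := by
      by_contra h0
      obtain ⟨u, hu, -⟩ := h.exists_lt t h0
      obtain ⟨v, -⟩ : u ∈ Set.range e := he ▸ hu
      exact hE.elim v
    rw [toricG, h.posetRank_eq_of_range e he, toricF, if_pos hE, h.eq_one t h0, h0]
    simp [gTrunc]
  · have hpos : 0 < ρ t := by
      obtain ⟨u⟩ := hN
      have := h.strictMono (show e u ∈ Set.Iio t from he ▸ Set.mem_range_self u)
      omega
    have hF : toricF Q = ∑ᶠ u ∈ Set.Iio t, γ u * (X - 1) ^ (ρ t - 1 - ρ u) := by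
      rw [toricF, if_neg (by simp), h.posetRank_eq_of_range e he, ← he,
        finsum_mem_range e.injective]
      refine finsum_congr fun u => ?_
      rw [← hG, hQ.elemRank_eq]
      rfl
    rw [toricG, h.posetRank_eq_of_range e he]
    refine gTrunc_eq_of_mul_eq _ _ _ (reflect (ρ t) (γ t)) ?_ ?_ ?_
    · have := h.sum_Iio_mul t
      rw [hF]
      linear_combination -this
    · intro k hk
      exact h.coeff_eq_zero t k (by omega) (by omega)
    · intro k hk
      rw [coeff_reflect_of_le _ (by omega)]
      exact h.coeff_eq_zero t _ (by omega) (by omega)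

theorem toricG_Iio [Finite P] (h : IsToricData ρ γ) (t : P) : toricG (Set.Iio t) = γ t := by
  induction hN : Nat.card P using Nat.strong_induction_on generalizing P with
  | _ N ih =>
    let e : Set.Iio t ↪o P := OrderEmbedding.subtype _
    have he : Set.range e = Set.Iio t := Subtype.range_coe
    refine h.toricG_eq_of_range_of_forall e he fun u => ?_
    refine ih (Nat.card (Set.Iio t)) ?_ (h.comap e (by rw [he]; exact isLowerSet_Iio t)) u rfl
    rw [← hN, Nat.card_coe_set_eq, ← Set.ncard_univ P]
    refine Set.ncard_lt_ncard (Set.ssubset_univ_iff.2 fun h => ?_) (Set.toFinite _)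
    exact lt_irrefl t (h ▸ Set.mem_univ t : t ∈ Set.Iio t)

theorem toricG_eq_of_range [Finite P] [Finite Q] (h : IsToricData ρ γ) (e : Q ↪o P) {t : P}
    (he : Set.range e = Set.Iio t) : toricG Q = γ t :=
  h.toricG_eq_of_range_of_forall e he fun u => (h.comap e (he ▸ isLowerSet_Iio t)).toricG_Iio u

theorem toricF_eq [Finite P] [Nonempty P] (h : IsToricData ρ γ) :
    toricF P = ∑ᶠ u : P, γ u * (X - 1) ^ (posetRank P - ρ u) := by
  rw [toricF, if_neg (by simp)]
  refine finsum_congr fun u => ?_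
  rw [← h.toricG_Iio, h.elemRank_eq]
  rfl

end IsToricData

/-! ### Bier posets and the effect of deleting a maximal element of the ideal -/

namespace Bier

variable {P : Type*} [PartialOrder P] {I : Set P}

/-- The endpoints of an interval, as an embedding of the Bier poset. -/
def endpoints (P : Type*) [PartialOrder P] (I : Set P) :
    Bier P I ↪o WithTop P × (WithTop P)ᵒᵈ where
  toFun s := ((OrderDual.ofDual s.1).fst, OrderDual.toDual (OrderDual.ofDual s.1).snd)
  inj' := by
    intro s s' h
    rw [Prod.mk.injEq] at h
    apply Subtype.ext
    apply OrderDual.ofDual.injective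
    exact NonemptyInterval.ext (Prod.ext h.1 (OrderDual.toDual.injective h.2))
  map_rel_iff' := by
    intro s s'
    exact Iff.rfl

theorem range_endpoints (I : Set P) : Set.range (endpoints P I) =
    {p | p.1 ∈ ((↑) : P → WithTop P) '' I ∧ OrderDual.ofDual p.2 ∉ ((↑) : P → WithTop P) '' I ∧
      p.1 ≤ OrderDual.ofDual p.2} := by
  ext ⟨x, y⟩
  constructor
  · rintro ⟨s, hs⟩
    rw [← hs]
    exact ⟨s.2.1, s.2.2, (OrderDual.ofDual s.1).fst_le_snd⟩
  · rintro ⟨h1, h2, h3⟩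
    exact ⟨⟨OrderDual.toDual ⟨(x, OrderDual.ofDual y), h3⟩, h1, h2⟩, rfl⟩

theorem coe_mem_image {P : Type*} {I : Set P} {x : P} :
    (x : WithTop P) ∈ ((↑) : P → WithTop P) '' I ↔ x ∈ I :=
  WithTop.coe_injective.mem_set_image

theorem isLowerSet_image (hI : IsLowerSet I) : IsLowerSet (((↑) : P → WithTop P) '' I) := by
  rintro a b hba ⟨x, hx, rfl⟩
  induction b using WithTop.recTopCoe with
  | top => simp at hba
  | coe b => exact ⟨b, hI (WithTop.coe_le_coe.1 hba) hx, rfl⟩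

theorem isLowerSet_range_endpoints (hI : IsLowerSet I) :
    IsLowerSet (Set.range (endpoints P I)) := by
  rw [range_endpoints]
  rintro ⟨x, y⟩ ⟨x', y'⟩ h ⟨h1, h2, h3⟩
  have hx : x' ≤ x := h.1
  have hy : OrderDual.ofDual y ≤ OrderDual.ofDual y' := h.2
  exact ⟨isLowerSet_image hI hx h1, fun h4 => h2 (isLowerSet_image hI hy h4),
    hx.trans (h3.trans hy)⟩

/-- Deleting `t` turns it from an admissible lower endpoint into an admissible upper one. Maximality
ensures that every y > t was admissible above `t`. The form with two unions lets sums be compared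
without set differences. -/
theorem range_endpoints_diff_union (hI : IsLowerSet I) {t : P} (ht : Maximal (· ∈ I) t) :
    Set.range (endpoints P (I \ {t})) ∪ {(t : WithTop P)} ×ˢ Set.Iio (OrderDual.toDual ↑t) =
      Set.range (endpoints P I) ∪ Set.Iio (t : WithTop P) ×ˢ {OrderDual.toDual ↑t} := by
  rw [range_endpoints, range_endpoints]
  ext ⟨x, y⟩
  obtain ⟨y, rfl⟩ := OrderDual.toDual.surjective y
  have hdiff : ∀ z : WithTop P, z ∈ ((↑) : P → WithTop P) '' (I \ {t}) ↔
      z ∈ ((↑) : P → WithTop P) '' I ∧ z ≠ t := by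
    intro z
    rw [Set.image_sdiff WithTop.coe_injective]
    simp
  have htI : (t : WithTop P) ∈ ((↑) : P → WithTop P) '' I := ⟨t, ht.1, rfl⟩
  have hgt : ∀ z : WithTop P, ↑t < z → z ∉ ((↑) : P → WithTop P) '' I := by
    rintro z hz ⟨w, hw, rfl⟩
    exact ht.not_gt hw (WithTop.coe_lt_coe.1 hz)
  have hlt : ∀ z : WithTop P, z ≤ ↑t → z ∈ ((↑) : P → WithTop P) '' I := fun z hz =>
    isLowerSet_image hI hz htI
  simp only [Set.mem_union, Set.mem_ofPred_eq, OrderDual.ofDual_toDual, hdiff, Set.mem_prod,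
    Set.mem_singleton_iff, Set.mem_Iio, OrderDual.toDual_lt_toDual, OrderDual.toDual_inj]
  constructor
  · rintro (⟨⟨h1, h2⟩, h3, h4⟩ | ⟨rfl, h⟩)
    · by_cases hy : y = t
      · subst hy
        exact Or.inr ⟨lt_of_le_of_ne h4 h2, rfl⟩
      · exact Or.inl ⟨h1, fun h5 => h3 ⟨h5, hy⟩, h4⟩
    · exact Or.inl ⟨htI, hgt _ h, h.le⟩
  · rintro (⟨h1, h2, h3⟩ | ⟨h, rfl⟩)
    · by_cases hx : x = t
      · subst hx
        exact Or.inr ⟨rfl, lt_of_le_of_ne h3 fun h4 => h2 (h4 ▸ htI)⟩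
      · exact Or.inl ⟨⟨h1, hx⟩, fun h4 => h2 h4.1, h3⟩
    · exact Or.inl ⟨⟨hlt _ h.le, h.ne⟩, fun h4 => h4.2 rfl, h.le⟩

end Bier

section

variable {P : Type*} [PartialOrder P] [Finite P] {ρ : WithTop P → ℕ} {γ : WithTop P → ℤ[X]}
  {σ : (WithTop P)ᵒᵈ → ℕ} {δ : (WithTop P)ᵒᵈ → ℤ[X]} {d : ℕ} {I : Set P}

/-- An interval [x,y] has rank d + 1 - (ρ y - ρ x), which is at most d since x < y. Equality is
reached by a maximal x of `I` and an element one rank above it. -/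
theorem IsToricData.posetRank_bier (h : IsToricData ρ γ) (h' : IsToricData σ δ)
    (hd : ∀ x, ρ x + σ (OrderDual.toDual x) = d + 1) (hI : IsLowerSet I) (hI0 : I.Nonempty) :
    posetRank (Bier P I) = d := by
  have hB := (h.prod h').comap (Bier.endpoints P I) (Bier.isLowerSet_range_endpoints hI)
  obtain ⟨x, hx⟩ := I.toFinite.exists_maximal hI0
  have hx0 : σ (OrderDual.toDual (x : WithTop P)) ≠ 0 := by
    have := h.strictMono (WithTop.coe_lt_top x)
    have := hd x
    have := hd ⊤
    omega
  obtain ⟨y, hy, hy'⟩ := h'.exists_lt _ hx0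
  have hxy : (x : WithTop P) < OrderDual.ofDual y := hy
  have hyI : OrderDual.ofDual y ∉ ((↑) : P → WithTop P) '' I := by
    rintro ⟨z, hz, hzy⟩
    rw [← hzy, WithTop.coe_lt_coe] at hxy
    exact hx.not_gt hz hxy
  let s : Bier P I := ⟨OrderDual.toDual ⟨(↑x, OrderDual.ofDual y), hxy.le⟩, ⟨x, hx.1, rfl⟩, hyI⟩
  have : Nonempty (Bier P I) := ⟨s⟩
  refine le_antisymm (ciSup_le fun u => ?_) ?_
  · rw [hB.elemRank_eq]
    have hu : (Bier.endpoints P I u) ∈ Set.range (Bier.endpoints P I) := ⟨u, rfl⟩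
    rw [Bier.range_endpoints] at hu
    have h1 : (Bier.endpoints P I u).1 < OrderDual.ofDual (Bier.endpoints P I u).2 :=
      lt_of_le_of_ne hu.2.2 fun h0 => hu.2.1 (h0 ▸ hu.1)
    have h2 := h.strictMono h1
    have h3 := hd (OrderDual.ofDual (Bier.endpoints P I u).2)
    simp only [OrderDual.toDual_ofDual] at h3
    simp only [Function.comp]
    omega
  · refine le_trans ?_ (le_ciSup (Set.finite_range _).bddAbove s)
    rw [hB.elemRank_eq]
    change d ≤ ρ x + σ y
    have := hd x
    omega

theorem IsToricData.toricF_bier (h : IsToricData ρ γ) (h' : IsToricData σ δ)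
    (hd : ∀ x, ρ x + σ (OrderDual.toDual x) = d + 1) (hI : IsLowerSet I) (hI0 : I.Nonempty) :
    toricF (Bier P I) = ∑ᶠ p ∈ Set.range (Bier.endpoints P I),
      γ p.1 * δ p.2 * (X - 1) ^ (d - (ρ p.1 + σ p.2)) := by
  have hB := (h.prod h').comap (Bier.endpoints P I) (Bier.isLowerSet_range_endpoints hI)
  have : Nonempty (Bier P I) := by
    obtain ⟨x, hx⟩ := hI0
    exact ⟨⟨OrderDual.toDual ⟨(↑x, ⊤), le_top⟩, ⟨x, hx, rfl⟩, by simp⟩⟩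
  rw [hB.toricF_eq, h.posetRank_bier h' hd hI hI0, finsum_mem_range (Bier.endpoints P I).injective]
  rfl

theorem IsToricData.sum_Iio_mul_const {Q : Type*} [PartialOrder Q] [Finite Q] {ρ : Q → ℕ}
    {γ : Q → ℤ[X]} (h : IsToricData ρ γ) (t : Q) (c : ℤ[X]) :
    (X - 1) * ∑ᶠ u ∈ Set.Iio t, c * γ u * (X - 1) ^ (ρ t - 1 - ρ u) =
      c * (reflect (ρ t) (γ t) - γ t) := by
  rw [← h.sum_Iio_mul t]
  simp only [finsum_mem_eq_finite_toFinset_sum _ (Set.toFinite _), Finset.mul_sum]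
  exact Finset.sum_congr rfl fun _ _ => by ring

/-- Removing a maximal element `t` from the ideal changes `g(Bier(P, I))` by the truncation of a
polynomial that depends on the intervals below and above `t` only. -/
theorem IsToricData.toricG_bier_diff (h : IsToricData ρ γ) (h' : IsToricData σ δ)
    (hd : ∀ x, ρ x + σ (OrderDual.toDual x) = d + 1) (hI : IsLowerSet I) {t : P}
    (ht : Maximal (· ∈ I) t) (ht0 : ρ t ≠ 0) :
    ∃ f : ℤ[X], toricG (Bier P (I \ {t})) - toricG (Bier P I) = gTrunc d f ∧
      (1 - X) * f = γ t * reflect (σ (OrderDual.toDual ↑t)) (δ (OrderDual.toDual ↑t)) -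
        δ (OrderDual.toDual ↑t) * reflect (ρ t) (γ t) := by
  have hI' : IsLowerSet (I \ {t}) := by
    intro a b hba ha
    refine ⟨hI hba ha.1, fun hbt => ha.2 ?_⟩
    rw [Set.mem_singleton_iff] at hbt ⊢
    subst hbt
    exact (ht.eq_of_le ha.1 hba).symm
  have hI0' : (I \ {t}).Nonempty := by
    obtain ⟨u, hu, -⟩ := h.exists_lt t ht0
    induction u using WithTop.recTopCoe with
    | top => simp at hu
    | coe u =>
      have hu' := WithTop.coe_lt_coe.1 hu
      exact ⟨u, hI hu'.le ht.1, hu'.ne⟩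
  have hI0 : I.Nonempty := ⟨t, ht.1⟩
  refine ⟨toricF (Bier P (I \ {t})) - toricF (Bier P I), ?_, ?_⟩
  · rw [gTrunc_sub, toricG, toricG, h.posetRank_bier h' hd hI' hI0',
      h.posetRank_bier h' hd hI hI0]
  rw [h.toricF_bier h' hd hI' hI0', h.toricF_bier h' hd hI hI0]
  have key := congrArg (fun S => ∑ᶠ p ∈ S, γ p.1 * δ p.2 * (X - 1) ^ (d - (ρ p.1 + σ p.2)))
    (Bier.range_endpoints_diff_union hI ht)
  have hd1 : Disjoint (Set.range (Bier.endpoints P (I \ {t})))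
      ({(t : WithTop P)} ×ˢ Set.Iio (OrderDual.toDual ↑t)) := by
    rw [Set.disjoint_left, Bier.range_endpoints]
    rintro ⟨x, y⟩ h1 h2
    obtain rfl : x = t := h2.1
    exact (Bier.coe_mem_image.1 h1.1).2 rfl
  have hd2 : Disjoint (Set.range (Bier.endpoints P I))
      (Set.Iio (t : WithTop P) ×ˢ {OrderDual.toDual ↑t}) := by
    rw [Set.disjoint_left, Bier.range_endpoints]
    rintro ⟨x, y⟩ h1 h2
    obtain rfl : y = OrderDual.toDual ↑t := h2.2
    exact h1.2.1 ⟨t, ht.1, rfl⟩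
  rw [finsum_mem_union hd1 (Set.toFinite _) (Set.toFinite _),
    finsum_mem_union hd2 (Set.toFinite _) (Set.toFinite _)] at key
  have hdt := hd t
  have e1 : ∑ᶠ p ∈ ({(t : WithTop P)} ×ˢ Set.Iio (OrderDual.toDual ↑t) :
        Set (WithTop P × (WithTop P)ᵒᵈ)), γ p.1 * δ p.2 * (X - 1) ^ (d - (ρ p.1 + σ p.2)) =
      ∑ᶠ y ∈ Set.Iio (OrderDual.toDual (t : WithTop P)),
        γ t * δ y * (X - 1) ^ (σ (OrderDual.toDual ↑t) - 1 - σ y) := by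
    refine (finsum_mem_eq_of_bijOn (fun y => ((t : WithTop P), y)) ⟨?_, ?_, ?_⟩ ?_).symm
    · intro y hy; exact ⟨rfl, hy⟩
    · intro y _ y' _ hyy; exact (Prod.mk.inj hyy).2
    · rintro ⟨x, y⟩ ⟨hx, hy⟩
      obtain rfl : x = t := hx
      exact ⟨y, hy, rfl⟩
    · intro y _
      dsimp only
      congr 2
      omega
  have e2 : ∑ᶠ p ∈ (Set.Iio (t : WithTop P) ×ˢ {OrderDual.toDual ↑t} :
        Set (WithTop P × (WithTop P)ᵒᵈ)), γ p.1 * δ p.2 * (X - 1) ^ (d - (ρ p.1 + σ p.2)) =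
      ∑ᶠ x ∈ Set.Iio (t : WithTop P),
        δ (OrderDual.toDual ↑t) * γ x * (X - 1) ^ (ρ t - 1 - ρ x) := by
    refine (finsum_mem_eq_of_bijOn (fun x => (x, OrderDual.toDual (t : WithTop P)))
      ⟨?_, ?_, ?_⟩ ?_).symm
    · intro y hy; exact ⟨hy, rfl⟩
    · intro y _ y' _ hyy; exact (Prod.mk.inj hyy).1
    · rintro ⟨x, y⟩ ⟨hx, hy⟩
      obtain rfl : y = OrderDual.toDual ↑t := hy
      exact ⟨x, hx, rfl⟩
    · intro x _
      dsimp only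
      rw [mul_comm (γ x)]
      congr 2
      omega
  rw [e1, e2] at key
  have k1 := h'.sum_Iio_mul_const (OrderDual.toDual ↑t) (γ t)
  have k2 := h.sum_Iio_mul_const t (δ (OrderDual.toDual ↑t))
  -- `key` is the exchange identity; after multiplication by 1 - x the recursion evaluates both
  -- exchanged sums.
  linear_combination (1 - X) * key + k1 - k2

end

/-! ### Closed sets of the multiplex incidence relation and their ranks -/

namespace Multiplex

/-- The incidence of the vertex `j` with the facet `i` of a multiplex; it is symmetric. -/
def Rel (d n i j : ℕ) : Prop :=
  (i = j ∧ (i = 0 ∨ i = n)) ∨ (i ≠ j ∧ i < j + d ∧ j < i + d)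

instance (d n i j : ℕ) : Decidable (Rel d n i j) := by unfold Rel; infer_instance

/-- The indices that are incident with all elements of `S`. -/
def nbr (d n : ℕ) (S : Finset ℕ) : Finset ℕ :=
  {j ∈ Finset.range (n + 1) | ∀ i ∈ S, Rel d n i j}

/-- The closed sets of the incidence relation. -/
def IsFlat (d n : ℕ) (V : Finset ℕ) : Prop := nbr d n (nbr d n V) = V

instance (d n : ℕ) (V : Finset ℕ) : Decidable (IsFlat d n V) := by unfold IsFlat; infer_instance

/-- The excess of the number of vertices of a face over its rank. -/
def excess (d : ℕ) (V : Finset ℕ) : ℕ := (V ×ˢ V).sup fun p => p.1 - p.2 - d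

/-- The rank of a face with vertex set `V`. -/
def rank (d : ℕ) (V : Finset ℕ) : ℕ := V.card - excess d V

variable {d n : ℕ} {S T U V W : Finset ℕ}

theorem Rel.symm {i j : ℕ} (h : Rel d n i j) : Rel d n j i := by
  unfold Rel at *; omega

theorem mem_nbr {j : ℕ} : j ∈ nbr d n S ↔ j ≤ n ∧ ∀ i ∈ S, Rel d n i j := by
  simp [nbr]

theorem nbr_subset_range (S : Finset ℕ) : nbr d n S ⊆ Finset.range (n + 1) :=
  Finset.filter_subset _ _

theorem subset_nbr_iff (hU : U ⊆ Finset.range (n + 1)) (hV : V ⊆ Finset.range (n + 1)) :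
    U ⊆ nbr d n V ↔ V ⊆ nbr d n U := by
  have hU' : ∀ u ∈ U, u ≤ n := fun u hu => by simpa [Nat.lt_succ_iff] using hU hu
  have hV' : ∀ u ∈ V, u ≤ n := fun u hu => by simpa [Nat.lt_succ_iff] using hV hu
  constructor
  · intro h v hv
    exact mem_nbr.2 ⟨hV' v hv, fun u hu => ((mem_nbr.1 (h hu)).2 v hv).symm⟩
  · intro h v hv
    exact mem_nbr.2 ⟨hU' v hv, fun u hu => ((mem_nbr.1 (h hu)).2 v hv).symm⟩

theorem nbr_anti (h : U ⊆ V) : nbr d n V ⊆ nbr d n U := fun _ hj =>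
  mem_nbr.2 ⟨(mem_nbr.1 hj).1, fun i hi => (mem_nbr.1 hj).2 i (h hi)⟩

theorem subset_nbr_nbr (hV : V ⊆ Finset.range (n + 1)) : V ⊆ nbr d n (nbr d n V) :=
  (subset_nbr_iff hV (nbr_subset_range _)).2 subset_rfl

theorem isFlat_nbr (hV : V ⊆ Finset.range (n + 1)) : IsFlat d n (nbr d n V) :=
  Finset.Subset.antisymm (nbr_anti (subset_nbr_nbr hV)) (subset_nbr_nbr (nbr_subset_range _))

theorem IsFlat.subset_range (h : IsFlat d n V) : V ⊆ Finset.range (n + 1) :=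
  h ▸ nbr_subset_range _

theorem IsFlat.le (h : IsFlat d n V) {v : ℕ} (hv : v ∈ V) : v ≤ n := by
  simpa [Nat.lt_succ_iff] using h.subset_range hv

theorem IsFlat.nbr (h : IsFlat d n V) : IsFlat d n (nbr d n V) := isFlat_nbr h.subset_range

theorem IsFlat.nbr_subset_nbr_iff (hU : IsFlat d n U) (hV : IsFlat d n V) :
    Multiplex.nbr d n U ⊆ Multiplex.nbr d n V ↔ V ⊆ U := by
  refine ⟨fun h => ?_, nbr_anti⟩
  rw [← hU, ← hV]
  exact nbr_anti h

theorem isFlat_iff (hV : V ⊆ Finset.range (n + 1)) : IsFlat d n V ↔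
    ∀ j ≤ n, j ∉ V → ∃ i ≤ n, (∀ k ∈ V, Rel d n i k) ∧ ¬ Rel d n i j := by
  constructor
  · intro h j hj hjV
    rw [← h, mem_nbr] at hjV
    push Not at hjV
    obtain ⟨i, hi, hij⟩ := hjV hj
    rw [mem_nbr] at hi
    exact ⟨i, hi.1, fun k hk => (hi.2 k hk).symm, hij⟩
  · intro h
    refine Finset.Subset.antisymm (fun j hj => ?_) (subset_nbr_nbr hV)
    rw [mem_nbr] at hj
    by_contra hjV
    obtain ⟨i, hi, hik, hij⟩ := h j hj.1 hjV
    exact hij (hj.2 i (mem_nbr.2 ⟨hi, fun k hk => (hik k hk).symm⟩))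

theorem exists_bounds (hV : V.Nonempty) : ∃ p ∈ V, ∃ q ∈ V, ∀ v ∈ V, p ≤ v ∧ v ≤ q :=
  ⟨V.min' hV, V.min'_mem hV, V.max' hV, V.max'_mem hV,
    fun v hv => ⟨V.min'_le v hv, V.le_max' v hv⟩⟩

theorem excess_mono (h : U ⊆ V) : excess d U ≤ excess d V :=
  Finset.sup_mono (Finset.product_subset_product h h)

theorem excess_eq {p q : ℕ} (hp : p ∈ V) (hq : q ∈ V) (h : ∀ v ∈ V, p ≤ v ∧ v ≤ q) :
    excess d V = q - p - d := by
  refine le_antisymm (Finset.sup_le fun x hx => ?_)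
    (Finset.le_sup (f := fun p : ℕ × ℕ => p.1 - p.2 - d) (Finset.mk_mem_product hq hp))
  rw [Finset.mem_product] at hx
  have := h _ hx.1
  have := h _ hx.2
  omega

theorem excess_eq_zero (h : ∀ u ∈ V, ∀ v ∈ V, u ≤ v + d) : excess d V = 0 := by
  refine Nat.le_zero.1 (Finset.sup_le fun x hx => ?_)
  rw [Finset.mem_product] at hx
  have := h _ hx.1 _ hx.2
  omega

theorem le_add_of_excess_eq_zero (h : excess d V = 0) {u v : ℕ} (hu : u ∈ V) (hv : v ∈ V) :
    u ≤ v + d := by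
  have : u - v - d ≤ excess d V :=
    Finset.le_sup (f := fun p : ℕ × ℕ => p.1 - p.2 - d) (Finset.mk_mem_product hu hv)
  omega

theorem rank_of_excess_eq_zero (h : excess d V = 0) : rank d V = V.card := by
  rw [rank, h, Nat.sub_zero]

section wide

variable {p q : ℕ}

/-- The extremes p and q confine i strictly between q - d and p + d. There only i ≠ v remains to be
asked: the exceptional self-incidences of 0 and n fall outside this range. -/
theorem IsFlat.mem_nbr_iff_of_wide (hV : IsFlat d n V) (hd : 1 ≤ d) (hp : p ∈ V) (hq : q ∈ V)
    (h : ∀ v ∈ V, p ≤ v ∧ v ≤ q) (hpq : p + d ≤ q) {i : ℕ} :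
    i ∈ Multiplex.nbr d n V ↔ q < i + d ∧ i < p + d ∧ i ∉ V := by
  have hqn := hV.le hq
  rw [mem_nbr]
  constructor
  · rintro ⟨hi, hr⟩
    have h1 := hr p hp
    have h2 := hr q hq
    unfold Rel at h1 h2
    refine ⟨by omega, by omega, fun hiV => ?_⟩
    have h3 := hr i hiV
    unfold Rel at h3
    omega
  · rintro ⟨h1, h2, h3⟩
    refine ⟨by omega, fun v hv => ?_⟩
    have := h v hv
    have : v ≠ i := fun h0 => h3 (h0 ▸ hv)
    unfold Rel
    omega

theorem IsFlat.mem_iff_of_wide (hV : IsFlat d n V) (hd : 1 ≤ d) (hp : p ∈ V) (hq : q ∈ V)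
    (h : ∀ v ∈ V, p ≤ v ∧ v ≤ q) (hpq : p + d ≤ q) {v : ℕ} :
    v ∈ V ↔ p ≤ v ∧ v ≤ q ∧ v ∉ Multiplex.nbr d n V := by
  have hS := @IsFlat.mem_nbr_iff_of_wide d n V p q hV hd hp hq h hpq
  constructor
  · intro hv
    exact ⟨(h v hv).1, (h v hv).2, fun h0 => (hS.1 h0).2.2 hv⟩
  · rintro ⟨h1, h2, h3⟩
    have hqn := hV.le hq
    rw [← hV, mem_nbr]
    refine ⟨by omega, fun i hi => ?_⟩
    have h4 := hS.1 hi
    have : i ≠ v := fun h0 => h3 (h0 ▸ hi)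
    unfold Rel
    omega

theorem IsFlat.card_add_card_of_wide (hV : IsFlat d n V) (hd : 1 ≤ d) (hp : p ∈ V) (hq : q ∈ V)
    (h : ∀ v ∈ V, p ≤ v ∧ v ≤ q) (hpq : p + d ≤ q) :
    V.card + (Multiplex.nbr d n V).card = q + 1 - p := by
  have hS := @IsFlat.mem_nbr_iff_of_wide d n V p q hV hd hp hq h hpq
  rw [← Finset.card_union_of_disjoint, ← Nat.card_Icc]
  · congr 1
    ext v
    rw [Finset.mem_union, hV.mem_iff_of_wide hd hp hq h hpq, Finset.mem_Icc]
    have : v ∈ Multiplex.nbr d n V → p ≤ v ∧ v ≤ q := fun h0 => by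
      have := hS.1 h0
      omega
    tauto
  · rw [Finset.disjoint_left]
    intro v hv h0
    exact (hS.1 h0).2.2 hv

theorem IsFlat.card_nbr_of_wide (hV : IsFlat d n V) (hd : 1 ≤ d) (hp : p ∈ V) (hq : q ∈ V)
    (h : ∀ v ∈ V, p ≤ v ∧ v ≤ q) (hpq : p + d ≤ q) :
    (Multiplex.nbr d n V).card = 0 ∨ (Multiplex.nbr d n V).card + (q - p) + 1 ≤ 2 * d := by
  have hS := @IsFlat.mem_nbr_iff_of_wide d n V p q hV hd hp hq h hpq
  have : Multiplex.nbr d n V ⊆ Finset.Ico (q + 1 - d) (p + d) := fun i hi => by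
    have := hS.1 hi
    rw [Finset.mem_Ico]
    omega
  have h1 := Finset.card_le_card this
  rw [Nat.card_Ico] at h1
  omega

/-- `V` and the facets through it partition the indices from p to q. The bound on the number of
facets ensures that the subtraction in `rank` is not truncated. -/
theorem IsFlat.rank_of_wide (hV : IsFlat d n V) (hd : 1 ≤ d) (hp : p ∈ V) (hq : q ∈ V)
    (h : ∀ v ∈ V, p ≤ v ∧ v ≤ q) (hpq : p + d ≤ q) :
    rank d V + (Multiplex.nbr d n V).card = d + 1 := by
  have h1 := hV.card_add_card_of_wide hd hp hq h hpq
  have h2 := hV.card_nbr_of_wide hd hp hq h hpq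
  rw [rank, excess_eq hp hq h] at *
  omega

end wide

theorem card_le_of_lt_add (h : ∀ u ∈ V, ∀ v ∈ V, u < v + d) : V.card ≤ d := by
  rcases V.eq_empty_or_nonempty with rfl | hV
  · simp
  · obtain ⟨p, hp, q, hq, hb⟩ := exists_bounds hV
    have : V ⊆ Finset.Ico p (p + d) := fun v hv => by
      have := hb v hv
      have := h v hv p hp
      rw [Finset.mem_Ico]
      omega
    simpa using Finset.card_le_card this

theorem isFlat_empty (hd : 1 ≤ d) (hdn : d ≤ n) : IsFlat d n ∅ := by
  rw [isFlat_iff (by simp)]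
  intro j hj _
  by_cases h : j = 0
  · exact ⟨n, le_rfl, by simp, by unfold Rel; omega⟩
  · by_cases h' : j = n
    · exact ⟨0, by omega, by simp, by unfold Rel; omega⟩
    · exact ⟨j, hj, by simp, by unfold Rel; omega⟩

/-- Faces of excess zero are simplices: for each vertex j some facet contains the rest of `V` but
not j. The facet of index j itself serves, unless j is 0 or n or an end of a set of width d; then a
facet beyond one end of `V` or at distance d from an end is used. -/
theorem IsFlat.erase (hV : IsFlat d n V) (hd : 1 ≤ d) (hdn : d ≤ n) (h0 : excess d V = 0)
    (x : ℕ) : IsFlat d n (V.erase x) := by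
  by_cases hx : x ∈ V
  swap
  · rwa [Finset.erase_eq_of_notMem hx]
  obtain ⟨p, hp, q, hq, hb⟩ := exists_bounds ⟨x, hx⟩
  have hpq := le_add_of_excess_eq_zero h0 hq hp
  have hqn := hV.le hq
  have hbx := hb x hx
  rw [isFlat_iff ((Finset.erase_subset _ _).trans hV.subset_range)]
  have hV' := (isFlat_iff hV.subset_range).1 hV
  intro j hj hjV
  rw [Finset.mem_erase, not_and_or, not_not] at hjV
  by_cases hjV' : j ∈ V
  swap
  · obtain ⟨i, hi, hik, hij⟩ := hV' j hj hjV'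
    exact ⟨i, hi, fun k hk => hik k (Finset.mem_of_mem_erase hk), hij⟩
  obtain rfl : j = x := hjV.resolve_right (by simpa using hjV')
  -- At width exactly d, a facet through `V` that misses p - 1 could only have index q - 1, so q - 1
  -- is not in `V` if 0 < p. Symmetrically p + 1 is not in `V` if q < n.
  have hwide : p + d ≤ q → ∀ v ∈ V, (v < q → 0 < p → v + 1 < q) ∧
      (p < v → q < n → p + 1 < v) := by
    intro hpq' v hv
    have hm := @IsFlat.mem_iff_of_wide d n V p q hV hd hp hq hb hpq'
    have hm1 := @IsFlat.mem_nbr_iff_of_wide d n V p q hV hd hp hq hb hpq'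
    have hqp : q = p + d := by omega
    constructor
    · intro h1 h2
      by_contra h3
      obtain rfl : v + 1 = q := by omega
      obtain ⟨i, hi, hik, hij⟩ := hV' (p - 1) (by omega) (fun h => by have := hb _ h; omega)
      have hi' : i ∈ Multiplex.nbr d n V := mem_nbr.2 ⟨hi, fun k hk => (hik k hk).symm⟩
      have h4 := hm1.1 hi'
      have : i ≠ v := fun h5 => h4.2.2 (h5 ▸ hv)
      unfold Rel at hij
      omega
    · intro h1 h2
      by_contra h3
      obtain rfl : v = p + 1 := by omega
      obtain ⟨i, hi, hik, hij⟩ := hV' (q + 1) (by omega) (fun h => by have := hb _ h; omega)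
      have hi' : i ∈ Multiplex.nbr d n V := mem_nbr.2 ⟨hi, fun k hk => (hik k hk).symm⟩
      have h4 := hm1.1 hi'
      have : i ≠ p + 1 := fun h5 => h4.2.2 (h5 ▸ hv)
      unfold Rel at hij
      omega
  have wit : ∀ i ≤ n, (∀ k ∈ V, k ≠ j → Rel d n i k) → ¬ Rel d n i j →
      ∃ i ≤ n, (∀ k ∈ V.erase j, Rel d n i k) ∧ ¬ Rel d n i j := fun i hi h1 h2 =>
    ⟨i, hi, fun k hk => h1 k (Finset.mem_of_mem_erase hk) (Finset.ne_of_mem_erase hk), h2⟩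
  by_cases hj1 : j ≠ 0 ∧ j ≠ n ∧ (j < p + d) ∧ q < j + d
  · refine wit j hj (fun k hk hkj => ?_) (by unfold Rel; omega)
    have := hb k hk
    unfold Rel; omega
  by_cases hjq : j = q ∧ (j ≠ p ∨ 0 < p)
  · by_cases hw : p + d ≤ q
    · refine wit (p - 1) (by omega) (fun k hk hkj => ?_) (by unfold Rel; omega)
      have := hb k hk
      have := hwide hw k hk
      unfold Rel; omega
    · refine wit (q - d) (by omega) (fun k hk hkj => ?_) (by unfold Rel; omega)
      have := hb k hk
      unfold Rel; omega
  · by_cases hw : p + d ≤ q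
    -- There is no facet q + 1 when q = n; the facet n then does the same work.
    · refine wit (q + 1 - (if q = n then 1 else 0)) (by split_ifs <;> omega) (fun k hk hkj => ?_)
        (by split_ifs <;> unfold Rel <;> omega)
      have := hb k hk
      have := hwide hw k hk
      split_ifs <;> unfold Rel <;> omega
    · refine wit (p + d) (by omega) (fun k hk hkj => ?_) (by unfold Rel; omega)
      have := hb k hk
      unfold Rel; omega

theorem IsFlat.of_subset (hV : IsFlat d n V) (hd : 1 ≤ d) (hdn : d ≤ n) (h0 : excess d V = 0)
    (hU : U ⊆ V) : IsFlat d n U := by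
  have : ∀ W : Finset ℕ, IsFlat d n (V \ W) := by
    intro W
    induction W using Finset.induction_on with
    | empty => simpa using hV
    | insert x W _ ih =>
      rw [Finset.sdiff_insert]
      exact ih.erase hd hdn (Nat.le_zero.1 (h0 ▸ excess_mono Finset.sdiff_subset)) x
  have h := this (V \ U)
  rwa [Finset.sdiff_sdiff_eq_self hU] at h

end Multiplex

namespace Multiplex

variable {d n : ℕ} {S T U V W : Finset ℕ}

theorem le_of_lt_add_nbr (hd : 1 ≤ d) {u v : ℕ} (hu : u ∈ V) (hv : v ∈ nbr d n V) :
    u < v + d ∧ v < u + d := by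
  have := (mem_nbr.1 hv).2 u hu
  unfold Rel at this
  omega

/-- The union of `V` and its set `S` of facets is maximal among index sets of spread below d, hence
a window of d consecutive indices. The two sets can share only 0 or n. They share exactly one end of
the window, since otherwise the window could be extended at the other end. -/
theorem IsFlat.card_add_card_of_narrow (hV : IsFlat d n V) (hd : 1 ≤ d) (hdn : d ≤ n)
    (h : ∀ u ∈ V, ∀ v ∈ V, u < v + d)
    (h' : ∀ u ∈ Multiplex.nbr d n V, ∀ v ∈ Multiplex.nbr d n V, u < v + d) :
    V.card + (Multiplex.nbr d n V).card = d + 1 := by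
  set S := Multiplex.nbr d n V with hS
  have hrel : ∀ v ∈ V, ∀ s ∈ S, Rel d n v s := fun v hv s hs => (mem_nbr.1 hs).2 v hv
  have hle : ∀ v ∈ V ∪ S, v ≤ n := fun v hv => by
    rcases Finset.mem_union.1 hv with hv | hv
    · exact hV.le hv
    · exact hV.nbr.le hv
  have memV : ∀ x ≤ n, (∀ s ∈ S, Rel d n s x) → x ∈ V := fun x hx hxs => by
    rw [← hV]; exact mem_nbr.2 ⟨hx, hxs⟩
  have memS : ∀ x ≤ n, (∀ s ∈ V, Rel d n s x) → x ∈ S := fun x hx hxs => mem_nbr.2 ⟨hx, hxs⟩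
  have hspan : ∀ u ∈ V ∪ S, ∀ v ∈ V ∪ S, u < v + d := by
    intro u hu v hv
    rcases Finset.mem_union.1 hu with hu | hu <;> rcases Finset.mem_union.1 hv with hv | hv
    · exact h u hu v hv
    · exact (le_of_lt_add_nbr hd hu hv).1
    · exact (le_of_lt_add_nbr hd hv hu).2
    · exact h' u hu v hv
  have hmax : ∀ x ≤ n, (∀ u ∈ V ∪ S, u < x + d ∧ x < u + d) → x ∈ V ∪ S := by
    intro x hx hu
    by_cases hxV : x ∈ V
    · exact Finset.mem_union_left _ hxV
    · refine Finset.mem_union_right _ (memS x hx fun v hv => ?_)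
      have := hu v (Finset.mem_union_left _ hv)
      have : v ≠ x := fun h0 => hxV (h0 ▸ hv)
      unfold Rel; omega
  have hne : (V ∪ S).Nonempty := by
    by_contra h0
    have := hmax 0 (by omega) (by simp [Finset.not_nonempty_iff_eq_empty.1 h0])
    exact h0 ⟨0, this⟩
  obtain ⟨p, hp, q, hq, hb⟩ := exists_bounds hne
  have hpq := hspan q hq p hp
  have hqn := hle q hq
  have hpn := hle p hp
  have hlen : q + 1 = p + d := by
    by_contra h0
    by_cases hqn' : q = n
    · have := hb _ (hmax (p - 1) (by omega) fun u hu => by have := hb u hu; omega)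
      omega
    · have := hb _ (hmax (q + 1) (by omega) fun u hu => by have := hb u hu; omega)
      omega
  have hunion : V ∪ S = Finset.Icc p q := by
    ext x
    rw [Finset.mem_Icc]
    refine ⟨hb x, fun hx => hmax x (by omega) fun u hu => ?_⟩
    have := hb u hu
    omega
  have hinter : ∃ z, V ∩ S = {z} := by
    have key : ∀ x ∈ V ∩ S, x = 0 ∨ x = n := by
      intro x hx
      rw [Finset.mem_inter] at hx
      have := hrel x hx.1 x hx.2
      unfold Rel at this; omega
    have hS' : ∀ s ∈ S, p ≤ s ∧ s ≤ q := fun s hs => hb s (Finset.mem_union_right _ hs)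
    have hV' : ∀ s ∈ V, p ≤ s ∧ s ≤ q := fun s hs => hb s (Finset.mem_union_left _ hs)
    by_cases hqn' : q = n
    · have hqV : q ∈ V := by
        by_contra hqV
        have hqS : q ∈ S := (Finset.mem_union.1 hq).resolve_left hqV
        have := hb _ (Finset.mem_union_right V (memS (p - 1) (by omega) fun v hv => by
          have := hV' v hv
          have : v ≠ q := fun h0 => hqV (h0 ▸ hv)
          unfold Rel; omega))
        omega
      have hqS : q ∈ S := by
        by_contra hqS
        have := hb _ (Finset.mem_union_left S (memV (p - 1) (by omega) fun v hv => by
          have := hS' v hv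
          have : v ≠ q := fun h0 => hqS (h0 ▸ hv)
          unfold Rel; omega))
        omega
      refine ⟨q, Finset.eq_singleton_iff_unique_mem.2
        ⟨Finset.mem_inter.2 ⟨hqV, hqS⟩, fun x hx => ?_⟩⟩
      have := key x hx
      have := hV' x (Finset.mem_inter.1 hx).1
      omega
    · have hpV : p ∈ V := by
        by_contra hpV
        have := hb _ (Finset.mem_union_right V (memS (q + 1) (by omega) fun v hv => by
          have := hV' v hv
          have : v ≠ p := fun h0 => hpV (h0 ▸ hv)
          unfold Rel; omega))
        omega
      have hpS : p ∈ S := by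
        by_contra hpS
        have := hb _ (Finset.mem_union_left S (memV (q + 1) (by omega) fun v hv => by
          have := hS' v hv
          have : v ≠ p := fun h0 => hpS (h0 ▸ hv)
          unfold Rel; omega))
        omega
      refine ⟨p, Finset.eq_singleton_iff_unique_mem.2
        ⟨Finset.mem_inter.2 ⟨hpV, hpS⟩, fun x hx => ?_⟩⟩
      have := key x hx
      have := key p (Finset.mem_inter.2 ⟨hpV, hpS⟩)
      have := hV' x (Finset.mem_inter.1 hx).1
      omega
  obtain ⟨z, hz⟩ := hinter
  have := Finset.card_union_add_card_inter V S
  rw [hunion, hz, Nat.card_Icc, Finset.card_singleton] at this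
  omega

theorem lt_add_or_exists_wide (d : ℕ) (V : Finset ℕ) : (∀ u ∈ V, ∀ v ∈ V, u < v + d) ∨
    ∃ p ∈ V, ∃ q ∈ V, (∀ v ∈ V, p ≤ v ∧ v ≤ q) ∧ p + d ≤ q := by
  rcases V.eq_empty_or_nonempty with rfl | hV
  · simp
  · obtain ⟨p, hp, q, hq, hb⟩ := exists_bounds hV
    by_cases h : p + d ≤ q
    · exact Or.inr ⟨p, hp, q, hq, hb, h⟩
    · refine Or.inl fun u hu v hv => ?_
      have := hb u hu
      have := hb v hv
      omega

theorem excess_eq_zero_of_lt_add (h : ∀ u ∈ V, ∀ v ∈ V, u < v + d) : excess d V = 0 :=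
  excess_eq_zero fun u hu v hv => (h u hu v hv).le

theorem IsFlat.rank_nbr_of_wide {p q : ℕ} (hV : IsFlat d n V) (hd : 1 ≤ d) (hp : p ∈ V)
    (hq : q ∈ V) (h : ∀ v ∈ V, p ≤ v ∧ v ≤ q) (hpq : p + d ≤ q) :
    rank d (Multiplex.nbr d n V) = (Multiplex.nbr d n V).card := by
  refine rank_of_excess_eq_zero (excess_eq_zero fun u hu v hv => ?_)
  have hu := (hV.mem_nbr_iff_of_wide hd hp hq h hpq).1 hu
  have hv := (hV.mem_nbr_iff_of_wide hd hp hq h hpq).1 hv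
  omega

theorem IsFlat.rank_add_rank_nbr (hV : IsFlat d n V) (hd : 1 ≤ d) (hdn : d ≤ n) :
    rank d V + rank d (Multiplex.nbr d n V) = d + 1 := by
  rcases lt_add_or_exists_wide d V with h | ⟨p, hp, q, hq, hb, hpq⟩
  · rcases lt_add_or_exists_wide d (Multiplex.nbr d n V) with h' | ⟨p, hp, q, hq, hb, hpq⟩
    · rw [rank_of_excess_eq_zero (excess_eq_zero_of_lt_add h),
        rank_of_excess_eq_zero (excess_eq_zero_of_lt_add h')]
      exact hV.card_add_card_of_narrow hd hdn h h'
    · have h1 := hV.nbr.rank_nbr_of_wide hd hp hq hb hpq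
      have h2 := hV.nbr.rank_of_wide hd hp hq hb hpq
      rw [hV] at h1 h2
      omega
  · rw [hV.rank_nbr_of_wide hd hp hq hb hpq, hV.rank_of_wide hd hp hq hb hpq]

theorem rank_le_card (d : ℕ) (V : Finset ℕ) : rank d V ≤ V.card := Nat.sub_le _ _

/-- For wide `V` the rank is d + 1 minus the number of facets through it, so facets are counted. If
`U` is narrow, it lies together with these facets, disjointly, in a window of length d. -/
theorem IsFlat.rank_lt_rank (hU : IsFlat d n U) (hV : IsFlat d n V) (hd : 1 ≤ d) (h : U ⊂ V) :
    rank d U < rank d V := by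
  rcases lt_add_or_exists_wide d V with h1 | ⟨p, hp, q, hq, hb, hpq⟩
  · rw [rank_of_excess_eq_zero (excess_eq_zero_of_lt_add h1)]
    exact (rank_le_card d U).trans_lt (Finset.card_lt_card h)
  · have hrV := hV.rank_of_wide hd hp hq hb hpq
    have hS : Multiplex.nbr d n V ⊂ Multiplex.nbr d n U := by
      refine Finset.ssubset_iff_subset_ne.2 ⟨nbr_anti h.1, fun h0 => h.2 ?_⟩
      exact (hU.nbr_subset_nbr_iff hV).1 h0.ge
    rcases lt_add_or_exists_wide d U with h2 | ⟨p', hp', q', hq', hb', hpq'⟩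
    · rw [rank_of_excess_eq_zero (excess_eq_zero_of_lt_add h2)]
      have hdisj : Disjoint U (Multiplex.nbr d n V) := by
        rw [Finset.disjoint_left]
        intro u hu hu'
        exact ((hV.mem_nbr_iff_of_wide hd hp hq hb hpq).1 hu').2.2 (h.1 hu)
      have : (U ∪ Multiplex.nbr d n V).card ≤ d := by
        refine card_le_of_lt_add fun u hu v hv => ?_
        rcases Finset.mem_union.1 hu with hu | hu <;> rcases Finset.mem_union.1 hv with hv | hv
        · exact h2 u hu v hv
        · exact (le_of_lt_add_nbr hd (h.1 hu) hv).1
        · exact (le_of_lt_add_nbr hd (h.1 hv) hu).2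
        · have hu := (hV.mem_nbr_iff_of_wide hd hp hq hb hpq).1 hu
          have hv := (hV.mem_nbr_iff_of_wide hd hp hq hb hpq).1 hv
          omega
      rw [Finset.card_union_of_disjoint hdisj] at this
      omega
    · have hrU := hU.rank_of_wide hd hp' hq' hb' hpq'
      have := Finset.card_lt_card hS
      omega

/-- By symmetry this window is both the vertex set of facet n and the set of facets through vertex
n. It has excess zero, so all its subsets are closed and the faces through vertex n are easy to
list. -/
theorem nbr_singleton_last (hd : 1 ≤ d) : nbr d n {n} = Finset.Icc (n + 1 - d) n := by
  ext j
  simp only [mem_nbr, Finset.mem_singleton, forall_eq, Finset.mem_Icc]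
  unfold Rel
  constructor <;> intro h <;> omega

theorem isFlat_Icc_last (hd : 1 ≤ d) : IsFlat d n (Finset.Icc (n + 1 - d) n) := by
  rw [← nbr_singleton_last hd]
  exact isFlat_nbr (by simp)

theorem excess_Icc_last : excess d (Finset.Icc (n + 1 - d) n) = 0 := by
  refine excess_eq_zero fun u hu v hv => ?_
  rw [Finset.mem_Icc] at hu hv
  omega

theorem IsFlat.exists_rank_add_one (hV : IsFlat d n V) (hd : 2 ≤ d) (hdn : d ≤ n)
    (h0 : rank d V ≠ 0) : ∃ U, IsFlat d n U ∧ U ⊂ V ∧ rank d U + 1 = rank d V := by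
  have hne : V.Nonempty := by
    rw [Finset.nonempty_iff_ne_empty]
    rintro rfl
    simp [rank] at h0
  by_cases hex : excess d V = 0
  · obtain ⟨x, hx⟩ := hne
    refine ⟨V.erase x, hV.erase (by omega) hdn hex x, Finset.erase_ssubset hx, ?_⟩
    rw [rank_of_excess_eq_zero hex, rank_of_excess_eq_zero
      (Nat.le_zero.1 (hex ▸ excess_mono (Finset.erase_subset _ _))), Finset.card_erase_add_one hx]
  obtain ⟨p, hp, q, hq, hb⟩ := exists_bounds hne
  have hexV := excess_eq hp hq hb (d := d)
  have hpq : p + d ≤ q := by omega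
  have hrV := hV.rank_of_wide (by omega) hp hq hb hpq
  have hm := @IsFlat.mem_nbr_iff_of_wide d n V p q hV (by omega) hp hq hb hpq
  have hm' := @IsFlat.mem_iff_of_wide d n V p q hV (by omega) hp hq hb hpq
  have hqn := hV.le hq
  by_cases hS : (Multiplex.nbr d n V).card = 0
  · refine ⟨Finset.Icc (n + 1 - d) n, isFlat_Icc_last (by omega), ?_, ?_⟩
    · have hmem : ∀ v, p ≤ v → v ≤ q → v ∈ V := fun v h1 h2 => by
        rw [Finset.card_eq_zero] at hS
        rw [hm', hS]
        exact ⟨h1, h2, by simp⟩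
      have hVn : Multiplex.nbr d n V = ∅ := Finset.card_eq_zero.1 hS
      have hall : ∀ v ≤ n, v ∈ V := by
        intro v hv
        rw [← hV, hVn, mem_nbr]
        exact ⟨hv, by simp⟩
      refine Finset.ssubset_iff_subset_ne.2 ⟨fun v hv => hall v (Finset.mem_Icc.1 hv).2, ?_⟩
      rintro rfl
      rw [Finset.mem_Icc] at hp hq
      omega
    · rw [rank_of_excess_eq_zero excess_Icc_last, Nat.card_Icc]
      omega
  · have hqd : q - d ∈ V := by
      rw [hm', hm]; omega
    have hq1 : q - 1 ∈ V := by
      rw [hm', hm]; omega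
    -- The facet q - d misses only q - d and q in `V`: two vertices go and the excess drops by one.
    refine ⟨(V.erase q).erase (q - d), ?_, ?_, ?_⟩
    · rw [isFlat_iff (((Finset.erase_subset _ _).trans (Finset.erase_subset _ _)).trans
        hV.subset_range)]
      intro j hj hjU
      by_cases hjV : j ∈ V
      · have hj' : j = q - d ∨ j = q := by
          by_contra hc
          push Not at hc
          exact hjU (Finset.mem_erase.2 ⟨hc.1, Finset.mem_erase.2 ⟨hc.2, hjV⟩⟩)
        refine ⟨q - d, by omega, fun k hk => ?_, by unfold Rel; omega⟩
        simp only [Finset.mem_erase] at hk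
        have := hb k hk.2.2
        obtain ⟨s, hs⟩ := Finset.card_ne_zero.1 hS
        have := hm.1 hs
        unfold Rel; omega
      · obtain ⟨i, hi, hik, hij⟩ := (isFlat_iff hV.subset_range).1 hV j hj hjV
        exact ⟨i, hi, fun k hk => hik k (Finset.mem_of_mem_erase (Finset.mem_of_mem_erase hk)),
          hij⟩
    · exact (Finset.erase_subset _ _).trans_ssubset (Finset.erase_ssubset hq)
    · have hex' : excess d ((V.erase q).erase (q - d)) = q - 1 - p - d := by
        refine excess_eq (Finset.mem_erase.2 ⟨by omega, Finset.mem_erase.2 ⟨by omega, hp⟩⟩)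
          (Finset.mem_erase.2 ⟨by omega, Finset.mem_erase.2 ⟨by omega, hq1⟩⟩) fun v hv => ?_
        simp only [Finset.mem_erase] at hv
        have := hb v hv.2.2
        omega
      have hc1 := Finset.card_erase_add_one hq
      have hc2 := Finset.card_erase_add_one (Finset.mem_erase.2 ⟨by omega, hqd⟩ :
        q - d ∈ V.erase q)
      rw [rank, rank, hex', hexV]
      rw [rank, hexV] at h0
      omega

end Multiplex

/-! ### The recursion for the linear polynomials `gPoly` -/

namespace Multiplex

variable {d n m : ℕ} {S T U V W t u : Finset ℕ}

/-- A closed set of width above d lies in at most d - 2 facets. Thus a linear term occurs only from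
rank 3 on, as the degree bound demands. -/
theorem IsFlat.three_le_rank (hV : IsFlat d n V) (hd : 2 ≤ d) (h : excess d V ≠ 0) :
    3 ≤ rank d V := by
  have hne : V.Nonempty := by
    rw [Finset.nonempty_iff_ne_empty]
    rintro rfl
    simp [excess] at h
  obtain ⟨p, hp, q, hq, hb⟩ := exists_bounds hne
  have hexV := excess_eq hp hq hb (d := d)
  have h1 := hV.rank_of_wide (by omega) hp hq hb (by omega)
  have h2 := hV.card_nbr_of_wide (by omega) hp hq hb (by omega)
  omega

theorem rel_succ {i j : ℕ} (hi : i < m) : Rel d (m + 1) i j ↔ Rel d m i j := by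
  unfold Rel
  constructor <;> intro h <;> omega

/-- The new vertex m + 1 does not alter the incidences of facets of index below m. A face avoiding
it lies in a facet avoiding it, and such a facet has index at most m + 1 - d. -/
theorem isFlat_succ_iff (hd : 2 ≤ d) (hdm : d ≤ m) (hu : u ⊆ Finset.range (m + 1)) :
    IsFlat d (m + 1) u ↔ IsFlat d m u ∧ ∃ i, i + d ≤ m + 1 ∧ ∀ k ∈ u, Rel d m i k := by
  have hum : ∀ k ∈ u, k ≤ m := fun k hk => by simpa [Nat.lt_succ_iff] using hu hk
  rw [isFlat_iff (hu.trans (Finset.range_mono (by omega))), isFlat_iff hu]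
  constructor
  · intro h
    obtain ⟨i0, hi0, h1, h2⟩ := h (m + 1) le_rfl (fun h => by have := hum _ h; omega)
    have hi0' : i0 + d ≤ m + 1 := by unfold Rel at h2; omega
    have h1' : ∀ k ∈ u, Rel d m i0 k := fun k hk =>
      (rel_succ (by omega)).1 (h1 k hk)
    refine ⟨fun j hj hju => ?_, i0, hi0', h1'⟩
    obtain ⟨i, hi, hik, hij⟩ := h j (by omega) hju
    by_cases him : i < m
    · exact ⟨i, by omega, fun k hk => (rel_succ him).1 (hik k hk),
        fun h => hij ((rel_succ him).2 h)⟩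
    by_cases him' : i = m
    · subst him'
      by_cases hji : j = i
      · subst hji
        by_cases h3 : i0 + d ≤ j
        · exact ⟨i0, by omega, h1', by unfold Rel; omega⟩
        · refine ⟨j - d, by omega, fun k hk => ?_, by unfold Rel; omega⟩
          have h4 := h1 k hk
          have h5 := hik k hk
          have h6 : k ≠ j := fun h0 => hju (h0 ▸ hk)
          unfold Rel at *; omega
      · refine ⟨i, le_rfl, fun k hk => ?_, by unfold Rel at *; omega⟩
        have := hik k hk
        unfold Rel at *; omega
    · obtain rfl : i = m + 1 := by omega
      by_cases hj' : j + d = m + 1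
      · refine ⟨j, hj, fun k hk => ?_, by unfold Rel; omega⟩
        have := hik k hk
        have := hum k hk
        unfold Rel at *; omega
      · refine ⟨m, le_rfl, fun k hk => ?_, by unfold Rel at *; omega⟩
        have := hik k hk
        have := hum k hk
        unfold Rel at *; omega
  · rintro ⟨h, i0, hi0, h1⟩ j hj hju
    by_cases hjm : j = m + 1
    · exact ⟨i0, by omega, fun k hk => (rel_succ (by omega)).2 (h1 k hk),
        by unfold Rel; omega⟩
    obtain ⟨i, hi, hik, hij⟩ := h j (by omega) hju
    by_cases him : i < m
    · exact ⟨i, by omega, fun k hk => (rel_succ him).2 (hik k hk),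
        fun h => hij ((rel_succ him).1 h)⟩
    obtain rfl : i = m := by omega
    by_cases hiu : i ∈ u
    · refine ⟨i + 1, le_rfl, fun k hk => ?_, by unfold Rel at *; omega⟩
      have h2 := hik k hk
      have h3 := h1 k hk
      have h4 := h1 i hiu
      have h5 := hum k hk
      unfold Rel at *; omega
    · refine ⟨i, by omega, fun k hk => ?_, by unfold Rel at *; omega⟩
      have h2 := hik k hk
      have h3 : k ≠ i := fun h0 => hiu (h0 ▸ hk)
      unfold Rel at *; omega

theorem sum_Icc_pow {R : Type*} [CommRing R] (x : R) (h : S ⊆ W) :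
    ∑ T ∈ Finset.Icc S W, x ^ (T.card - S.card) = (x + 1) ^ (W.card - S.card) := by
  rw [Finset.Icc_eq_image_powerset h, Finset.sum_image]
  · rw [← Finset.card_sdiff_of_subset h, ← Finset.sum_pow_mul_eq_add_pow]
    refine Finset.sum_congr rfl fun T hT => ?_
    rw [Finset.mem_powerset] at hT
    rw [Finset.card_union_of_disjoint, Nat.add_sub_cancel_left, one_pow, mul_one]
    exact Finset.disjoint_of_subset_right hT Finset.disjoint_sdiff
  · intro T hT T' hT' h0
    simp only [Finset.coe_powerset, Set.mem_preimage, Set.mem_powerset_iff, Finset.coe_subset] at hT hT'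
    have d1 := Finset.disjoint_of_subset_right hT (Finset.disjoint_sdiff (s := S) (t := W))
    have d2 := Finset.disjoint_of_subset_right hT' (Finset.disjoint_sdiff (s := S) (t := W))
    have := congrArg (· \ S) h0
    simpa [Finset.union_sdiff_cancel_left d1, Finset.union_sdiff_cancel_left d2] using this

/-- The `g`-polynomial of the boundary of a face with vertex set `V`. -/
noncomputable def gPoly (d : ℕ) (V : Finset ℕ) : ℤ[X] := 1 + C (excess d V : ℤ) * X

/-- The closed sets, as a finite set. -/
def flats (d n : ℕ) : Finset (Finset ℕ) := {V ∈ (Finset.range (n + 1)).powerset | IsFlat d n V}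

theorem mem_flats : V ∈ flats d n ↔ IsFlat d n V := by
  rw [flats, Finset.mem_filter, Finset.mem_powerset, and_iff_right_iff_imp]
  exact IsFlat.subset_range

theorem gPoly_of_excess_eq_zero (h : excess d V = 0) : gPoly d V = 1 := by
  simp [gPoly, h]

theorem IsFlat.sum_of_excess_eq_zero (ht : IsFlat d n t) (hd : 2 ≤ d) (hdn : d ≤ n)
    (h0 : excess d t = 0) :
    ∑ u ∈ flats d n with u ⊆ t, gPoly d u * (X - 1) ^ (rank d t - rank d u) =
      X ^ rank d t := by
  have h1 : {u ∈ flats d n | u ⊆ t} = t.powerset := by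
    ext u
    rw [Finset.mem_filter, Finset.mem_powerset, mem_flats]
    exact ⟨fun h => h.2, fun h => ⟨ht.of_subset (by omega) hdn h0 h, h⟩⟩
  have h2 : (X : ℤ[X]) = 1 + (X - 1) := by ring
  rw [h1, rank_of_excess_eq_zero h0]
  conv_rhs => rw [h2, ← Finset.sum_pow_mul_eq_add_pow]
  refine Finset.sum_congr rfl fun u hu => ?_
  have h3 : excess d u = 0 := Nat.le_zero.1 (h0 ▸ excess_mono (Finset.mem_powerset.1 hu))
  rw [gPoly_of_excess_eq_zero h3, rank_of_excess_eq_zero h3, one_pow]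

theorem IsFlat.of_subset_Icc (hd : 1 ≤ d) (hdn : d ≤ n) (h : T ⊆ Finset.Icc (n + 1 - d) n) :
    IsFlat d n T :=
  (isFlat_Icc_last hd).of_subset hd hdn excess_Icc_last h

theorem rank_nbr_of_subset_Icc (hd : 1 ≤ d) (hdn : d ≤ n)
    (h : T ⊆ Finset.Icc (n + 1 - d) n) : rank d (nbr d n T) + T.card = d + 1 := by
  have h1 := (IsFlat.of_subset_Icc hd hdn h).rank_add_rank_nbr hd hdn
  rw [rank_of_excess_eq_zero (Nat.le_zero.1 (excess_Icc_last (d := d) (n := n) ▸ excess_mono h))]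
    at h1
  omega

/-- The faces between `nbr d n W` and `nbr d n S` correspond to the sets between `S` and `W`. -/
theorem sum_flats_nbr (hd : 1 ≤ d) (hdn : d ≤ n) (hW : W ⊆ Finset.Icc (n + 1 - d) n)
    (hS : S ⊆ W) :
    ∑ u ∈ flats d n with u ⊆ nbr d n S ∧ nbr d n u ⊆ W,
        gPoly d u * (X - 1) ^ (rank d (nbr d n S) - rank d u) =
      ∑ T ∈ Finset.Icc S W, gPoly d (nbr d n T) * (X - 1) ^ (T.card - S.card) := by
  have hr := rank_nbr_of_subset_Icc hd hdn (hS.trans hW)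
  have hSf := IsFlat.of_subset_Icc hd hdn (hS.trans hW)
  refine (Finset.sum_bij' (fun T _ => nbr d n T) (fun u _ => nbr d n u) ?_ ?_ ?_ ?_ ?_).symm
  · intro T hT
    rw [Finset.mem_Icc] at hT
    have hTf := IsFlat.of_subset_Icc hd hdn (hT.2.trans hW)
    rw [Finset.mem_filter, mem_flats]
    exact ⟨hTf.nbr, nbr_anti hT.1, by rw [hTf]; exact hT.2⟩
  · intro u hu
    rw [Finset.mem_filter, mem_flats] at hu
    rw [Finset.mem_Icc]
    exact ⟨(subset_nbr_iff hSf.subset_range hu.1.subset_range).2 hu.2.1, hu.2.2⟩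
  · intro T hT
    rw [Finset.mem_Icc] at hT
    exact IsFlat.of_subset_Icc hd hdn (hT.2.trans hW)
  · intro u hu
    rw [Finset.mem_filter, mem_flats] at hu
    exact hu.1
  · intro T hT
    rw [Finset.mem_Icc] at hT
    have := rank_nbr_of_subset_Icc hd hdn (hT.2.trans hW)
    have := Finset.card_le_card hT.1
    have h1 : T.card - S.card = rank d (nbr d n S) - rank d (nbr d n T) := by omega
    rw [h1]

theorem nbr_succ (h : S ⊆ Finset.range m) : nbr d m S = (nbr d (m + 1) S).erase (m + 1) := by
  ext j
  rw [Finset.mem_erase, mem_nbr, mem_nbr]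
  constructor
  · rintro ⟨h1, h2⟩
    exact ⟨by omega, by omega, fun i hi =>
      (rel_succ (Finset.mem_range.1 (h hi))).2 (h2 i hi)⟩
  · rintro ⟨h1, h2, h3⟩
    have h4 : j ≤ m := by omega
    exact ⟨h4, fun i hi => (rel_succ (Finset.mem_range.1 (h hi))).1 (h3 i hi)⟩

/-- All facets in `T` contain the last vertex of either multiplex, so the common vertices start at
the same p and end at m or m + 1. -/
theorem excess_nbr_succ (hd : 2 ≤ d) (hdm : d ≤ m) (hT : T ⊆ Finset.Ico (m + 2 - d) m) :
    excess d (nbr d (m + 1) T) = excess d (nbr d m T) + 1 := by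
  set p := T.sup fun i => i + 1 - d with hp
  have hT' : ∀ i ∈ T, i + 1 - d ≤ p ∧ m + 2 - d ≤ i ∧ i < m := fun i hi =>
    ⟨Finset.le_sup (f := fun i => i + 1 - d) hi, Finset.mem_Ico.1 (hT hi)⟩
  have hpm : p + d ≤ m := by
    have : p ≤ m - d := Finset.sup_le fun i hi => by have := hT' i hi; omega
    omega
  have hple : ∀ n' v, v ∈ nbr d n' T → p ≤ v := fun n' v hv =>
    Finset.sup_le fun i hi => by
      have := hT' i hi
      have := (mem_nbr.1 hv).2 i hi
      unfold Rel at this; omega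
  have hmem : ∀ n', m ≤ n' → n' ≤ m + 1 → p ∈ nbr d n' T ∧ n' ∈ nbr d n' T := by
    intro n' h1 h2
    refine ⟨mem_nbr.2 ⟨by omega, fun i hi => ?_⟩, mem_nbr.2 ⟨by omega, fun i hi => ?_⟩⟩ <;>
    · have := hT' i hi
      unfold Rel; omega
  have key : ∀ n', m ≤ n' → n' ≤ m + 1 → excess d (nbr d n' T) = n' - p - d := fun n' h1 h2 =>
    excess_eq (hmem n' h1 h2).1 (hmem n' h1 h2).2
      fun v hv => ⟨hple n' v hv, (mem_nbr.1 hv).1⟩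
  rw [key m le_rfl (by omega), key (m + 1) (by omega) le_rfl]
  omega

theorem excess_nbr_of_last_mem (hd : 1 ≤ d) (h : n ∈ T) : excess d (nbr d n T) = 0 := by
  have h1 : nbr d n T ⊆ nbr d n {n} := nbr_anti (Finset.singleton_subset_iff.2 h)
  rw [nbr_singleton_last hd] at h1
  exact Nat.le_zero.1 (excess_Icc_last (d := d) (n := n) ▸ excess_mono h1)

theorem excess_nbr_of_mem (h : m ∈ T) :
    excess d (nbr d (m + 1) T) = 0 := by
  refine excess_eq_zero fun u hu v hv => ?_
  have hu := mem_nbr.1 hu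
  have hv := mem_nbr.1 hv
  have h1 := hu.2 m h
  have h2 := hv.2 m h
  unfold Rel at h1 h2
  omega

theorem sum_Icc_insert {R : Type*} [CommRing R] (f : Finset ℕ → R) {a : ℕ} (ha : a ∉ W) :
    ∑ T ∈ Finset.Icc S (insert a W), f T =
      ∑ T ∈ Finset.Icc S W, f T + ∑ T ∈ Finset.Icc (insert a S) (insert a W), f T := by
  rw [← Finset.sum_union]
  · refine Finset.sum_congr ?_ fun _ _ => rfl
    ext T
    simp only [Finset.mem_union, Finset.mem_Icc]
    constructor
    · rintro ⟨h1, h2⟩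
      by_cases haT : a ∈ T
      · exact Or.inr ⟨Finset.insert_subset haT h1, h2⟩
      · exact Or.inl ⟨h1, (Finset.subset_insert_iff_of_notMem haT).1 h2⟩
    · rintro (⟨h1, h2⟩ | ⟨h1, h2⟩)
      · exact ⟨h1, h2.trans (Finset.subset_insert _ _)⟩
      · exact ⟨(Finset.subset_insert _ _).trans h1, h2⟩
  · rw [Finset.disjoint_left]
    intro T h1 h2
    rw [Finset.mem_Icc] at h1 h2
    exact ha (h1.2 (h2.1 (Finset.mem_insert_self _ _)))

/-- Comparison of the faces at the last vertex of a multiplex with the faces of the multiplex with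
one vertex less that disappear. -/
theorem sum_Icc_nbr_succ (hd : 2 ≤ d) (hdm : d ≤ m) (hS : S ⊆ Finset.Ico (m + 2 - d) m) :
    ∑ T ∈ Finset.Icc S (Finset.Icc (m + 2 - d) (m + 1)),
        gPoly d (nbr d (m + 1) T) * (X - 1) ^ (T.card - S.card) =
      ∑ T ∈ Finset.Icc S (Finset.Icc (m + 2 - d) m),
        gPoly d (nbr d m T) * (X - 1) ^ (T.card - S.card) + X ^ (d - S.card) := by
  have e1 : Finset.Icc (m + 2 - d) (m + 1) = insert (m + 1) (Finset.Icc (m + 2 - d) m) := by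
    ext x; simp only [Finset.mem_Icc, Finset.mem_insert]; omega
  have e2 : Finset.Icc (m + 2 - d) m = insert m (Finset.Ico (m + 2 - d) m) := by
    ext x; simp only [Finset.mem_Icc, Finset.mem_Ico, Finset.mem_insert]; omega
  have hSc := Finset.card_le_card hS
  rw [Nat.card_Ico] at hSc
  have hmS : m ∉ S := fun h => by simpa using hS h
  have hmS' : m + 1 ∉ S := fun h => by have := hS h; rw [Finset.mem_Ico] at this; omega
  have hS' : S ⊆ Finset.Icc (m + 2 - d) m := hS.trans Finset.Ico_subset_Icc_self
  -- The sets T are sorted by whether they contain m + 1, or else m. Those with m + 1 are new and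
  -- have excess zero; those with m contribute equally; for the rest the excess rises by one. The
  -- surplus is (X-1)X^(d-1-|S|) + X·X^(d-2-|S|) = X^(d-|S|).
  rw [e1, sum_Icc_insert _ (by simp), e2,
    sum_Icc_insert (fun T => gPoly d (nbr d (m + 1) T) * (X - 1) ^ (T.card - S.card)) (by simp),
    sum_Icc_insert (fun T => gPoly d (nbr d m T) * (X - 1) ^ (T.card - S.card)) (by simp)]
  have a1 : ∑ T ∈ Finset.Icc (insert (m + 1) S) (insert (m + 1) (insert m
      (Finset.Ico (m + 2 - d) m))), gPoly d (nbr d (m + 1) T) * (X - 1) ^ (T.card - S.card) =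
      (X - 1) * X ^ (d - 1 - S.card) := by
    have h1 := sum_Icc_pow (X - 1 : ℤ[X]) (Finset.insert_subset_insert (m + 1) (e2 ▸ hS'))
    rw [← e2, ← e1, Nat.card_Icc, Finset.card_insert_of_notMem hmS', sub_add_cancel] at h1
    rw [← e2, ← e1, show d - 1 - S.card = m + 1 + 1 - (m + 2 - d) - (S.card + 1) by omega, ← h1,
      Finset.mul_sum]
    refine Finset.sum_congr rfl fun T hT => ?_
    rw [Finset.mem_Icc] at hT
    have h2 := Finset.card_le_card hT.1
    rw [Finset.card_insert_of_notMem hmS'] at h2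
    rw [gPoly_of_excess_eq_zero (excess_nbr_of_last_mem (by omega)
      (hT.1 (Finset.mem_insert_self _ _))), one_mul, ← pow_succ']
    congr 1
    omega
  have a2 : ∑ T ∈ Finset.Icc (insert m S) (insert m (Finset.Ico (m + 2 - d) m)),
      gPoly d (nbr d (m + 1) T) * (X - 1) ^ (T.card - S.card) =
      ∑ T ∈ Finset.Icc (insert m S) (insert m (Finset.Ico (m + 2 - d) m)),
      gPoly d (nbr d m T) * (X - 1) ^ (T.card - S.card) := by
    refine Finset.sum_congr rfl fun T hT => ?_
    rw [Finset.mem_Icc] at hT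
    have hmT : m ∈ T := hT.1 (Finset.mem_insert_self _ _)
    rw [gPoly_of_excess_eq_zero (excess_nbr_of_last_mem (by omega) hmT),
      gPoly_of_excess_eq_zero (excess_nbr_of_mem hmT)]
  have a3 : ∑ T ∈ Finset.Icc S (Finset.Ico (m + 2 - d) m),
      gPoly d (nbr d (m + 1) T) * (X - 1) ^ (T.card - S.card) =
      ∑ T ∈ Finset.Icc S (Finset.Ico (m + 2 - d) m),
      gPoly d (nbr d m T) * (X - 1) ^ (T.card - S.card) + X * X ^ (d - 2 - S.card) := by
    have h1 := sum_Icc_pow (X - 1 : ℤ[X]) hS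
    rw [Nat.card_Ico, sub_add_cancel] at h1
    rw [show d - 2 - S.card = m - (m + 2 - d) - S.card by omega, ← h1, Finset.mul_sum,
      ← Finset.sum_add_distrib]
    refine Finset.sum_congr rfl fun T hT => ?_
    rw [Finset.mem_Icc] at hT
    rw [gPoly, gPoly, excess_nbr_succ hd hdm hT.2]
    push_cast
    rw [C_add, C_1]
    ring
  rw [a1, a2, a3, show d - S.card = d - 1 - S.card + 1 by omega,
    show d - 1 - S.card = d - 2 - S.card + 1 by omega]
  ring

/-- The polynomials `gPoly` satisfy the recursion of the toric `g`-polynomial. -/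
theorem IsFlat.sum_eq (ht : IsFlat d n t) (hd : 2 ≤ d) (hdn : d ≤ n) :
    ∑ u ∈ flats d n with u ⊆ t, gPoly d u * (X - 1) ^ (rank d t - rank d u) =
      X ^ rank d t + C (excess d t : ℤ) * X ^ (rank d t - 1) := by
  induction n, hdn using Nat.le_induction generalizing t with
  | base =>
    have h0 : excess d t = 0 := excess_eq_zero fun u hu v hv => by
      have := ht.le hu
      omega
    rw [ht.sum_of_excess_eq_zero hd le_rfl h0, h0]
    simp
  | succ m hdm ih =>
    by_cases h0 : excess d t = 0
    · rw [ht.sum_of_excess_eq_zero hd (by omega) h0, h0]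
      simp
    by_cases hmt : m + 1 ∈ t
    swap
    · have htm : t ⊆ Finset.range (m + 1) := fun v hv => by
        have := ht.le hv
        have : v ≠ m + 1 := fun h => hmt (h ▸ hv)
        rw [Finset.mem_range]; omega
      obtain ⟨ht', i, hi, hik⟩ := (isFlat_succ_iff hd hdm htm).1 ht
      rw [← ih ht']
      refine Finset.sum_congr ?_ fun _ _ => rfl
      ext u
      rw [Finset.mem_filter, Finset.mem_filter, mem_flats, mem_flats]
      refine and_congr_left fun hut => ?_
      rw [isFlat_succ_iff hd hdm (hut.trans htm)]
      exact and_iff_left ⟨i, hi, fun k hk => hik k (hut hk)⟩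
    obtain ⟨p, hp, q, hq, hb⟩ := exists_bounds ⟨_, hmt⟩
    obtain rfl : q = m + 1 := le_antisymm (ht.le hq) (hb _ hmt).2
    have hpq : p + d < m + 1 := by
      rw [excess_eq hp hq hb] at h0
      omega
    set S := Multiplex.nbr d (m + 1) t with hSdef
    have hS : S ⊆ Finset.Ico (m + 2 - d) m := fun i hi => by
      have := (ht.mem_nbr_iff_of_wide (by omega) hp hq hb hpq.le).1 hi
      rw [Finset.mem_Ico]
      omega
    have hSt : Multiplex.nbr d (m + 1) S = t := ht
    have hSt' : Multiplex.nbr d m S = t.erase (m + 1) := by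
      rw [nbr_succ (hS.trans fun i hi => by simp at hi ⊢; omega), hSt]
    have hSI : S ⊆ Finset.Icc (m + 2 - d) (m + 1) := hS.trans fun i hi => by
      simp only [Finset.mem_Ico, Finset.mem_Icc] at *; omega
    have hSI' : S ⊆ Finset.Icc (m + 2 - d) m := hS.trans Finset.Ico_subset_Icc_self
    have hI' : Finset.Icc (m + 2 - d) m ⊆ Finset.Icc (m + 1 - d) m :=
      Finset.Icc_subset_Icc_left (by omega)
    have hr1 := rank_nbr_of_subset_Icc (by omega) (show d ≤ m + 1 by omega) hSI
    have hr2 := rank_nbr_of_subset_Icc (by omega) hdm (hSI'.trans hI')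
    have hex := excess_nbr_succ hd hdm hS
    rw [hSt, hSt'] at hex
    rw [hSt] at hr1
    rw [hSt'] at hr2
    have ht' : IsFlat d m (t.erase (m + 1)) := by
      rw [← hSt']
      exact isFlat_nbr (hS.trans fun i hi => by simp at hi ⊢; omega)
    -- The faces of t and of t without m + 1 are split by whether all facets through them lie in the
    -- last window. Outside it both multiplexes have the same faces (`hsets`). Inside, the sum grows
    -- by X^(rank - 1), which is exactly what the increase of the excess by one requires.
    have key := ih ht'
    rw [← Finset.sum_filter_add_sum_filter_not _
      (fun u => Multiplex.nbr d m u ⊆ Finset.Icc (m + 2 - d) m), Finset.filter_filter,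
      Finset.filter_filter] at key
    rw [← Finset.sum_filter_add_sum_filter_not _
      (fun u => Multiplex.nbr d (m + 1) u ⊆ Finset.Icc (m + 2 - d) (m + 1)),
      Finset.filter_filter, Finset.filter_filter]
    have s1 := sum_flats_nbr (by omega) (show d ≤ m + 1 by omega) subset_rfl hSI
    have s2 := sum_flats_nbr (by omega) hdm hI' hSI'
    rw [hSt] at s1
    rw [hSt'] at s2
    rw [s2] at key
    rw [s1, sum_Icc_nbr_succ hd hdm hS]
    have hsets : {u ∈ flats d (m + 1) | u ⊆ t ∧
        ¬ Multiplex.nbr d (m + 1) u ⊆ Finset.Icc (m + 2 - d) (m + 1)} =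
        {u ∈ flats d m | u ⊆ t.erase (m + 1) ∧
          ¬ Multiplex.nbr d m u ⊆ Finset.Icc (m + 2 - d) m} := by
      ext u
      rw [Finset.mem_filter, Finset.mem_filter, mem_flats, mem_flats, Finset.subset_erase]
      constructor
      · rintro ⟨h1, h2, h3⟩
        have hmu : m + 1 ∉ u := fun hmu => h3 <| by
          have := nbr_anti (d := d) (n := m + 1) (Finset.singleton_subset_iff.2 hmu)
          rwa [nbr_singleton_last (by omega)] at this
        have hum : u ⊆ Finset.range (m + 1) := fun v hv => by
          have := h1.le hv
          have : v ≠ m + 1 := fun h => hmu (h ▸ hv)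
          rw [Finset.mem_range]; omega
        obtain ⟨h4, i, hi, hik⟩ := (isFlat_succ_iff hd hdm hum).1 h1
        refine ⟨h4, ⟨h2, hmu⟩, fun h5 => ?_⟩
        have := h5 (mem_nbr.2 ⟨by omega, fun k hk => (hik k hk).symm⟩)
        rw [Finset.mem_Icc] at this
        omega
      · rintro ⟨h1, ⟨h2, h3⟩, h4⟩
        obtain ⟨i, hi, hi'⟩ := Finset.not_subset.1 h4
        rw [mem_nbr] at hi
        rw [Finset.mem_Icc] at hi'
        have h5 := (isFlat_succ_iff hd hdm h1.subset_range).2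
          ⟨h1, i, by omega, fun k hk => (hi.2 k hk).symm⟩
        refine ⟨h5, h2, fun h6 => h3 ?_⟩
        rw [← h5, mem_nbr]
        refine ⟨le_rfl, fun k hk => ?_⟩
        have := h6 hk
        rw [Finset.mem_Icc] at this
        unfold Rel; omega
    have hrr : rank d t = rank d (t.erase (m + 1)) := by omega
    rw [hsets, hrr, hex, show d - S.card = rank d (t.erase (m + 1)) - 1 by omega]
    push_cast
    rw [C_add, C_1]
    linear_combination key

end Multiplex

/-! ### Toric data and self-duality of the lattice of closed sets -/

namespace Multiplex

variable {d n : ℕ}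

theorem reflect_one_add_C_mul_X {r : ℕ} (hr : 1 ≤ r) (c : ℤ) :
    reflect r (1 + C c * X) = X ^ r + C c * X ^ (r - 1) := by
  rw [reflect_add, reflect_one, ← pow_one (X : ℤ[X]), reflect_C_mul_X_pow, revAt_le hr, pow_one]

theorem isToricData (hd : 2 ≤ d) (hdn : d ≤ n) :
    IsToricData (fun V : {V : Finset ℕ // IsFlat d n V} => rank d V.1)
      (fun V => gPoly d V.1) where
  strictMono U V h := U.2.rank_lt_rank V.2 (by omega) h
  exists_lt V hV := by
    obtain ⟨U, hU, hUV, hr⟩ := V.2.exists_rank_add_one hd hdn hV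
    exact ⟨⟨U, hU⟩, hUV, hr⟩
  eq_one V hV := by
    refine gPoly_of_excess_eq_zero ?_
    by_contra h
    have := V.2.three_le_rank hd h
    omega
  coeff_eq_zero V k hk hV := by
    by_cases h : excess d V.1 = 0
    · rw [gPoly_of_excess_eq_zero h, coeff_one, if_neg (by omega)]
    · have := V.2.three_le_rank hd h
      rw [gPoly, coeff_add, coeff_C_mul, coeff_one, coeff_X, if_neg (by omega),
        if_neg (by omega)]
      simp
  sum_eq t := by
    have h1 : reflect (rank d t.1) (gPoly d t.1) =
        X ^ rank d t.1 + C (excess d t.1 : ℤ) * X ^ (rank d t.1 - 1) := by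
      by_cases h : excess d t.1 = 0
      · rw [gPoly_of_excess_eq_zero h, h]
        simp [reflect_one]
      · have := t.2.three_le_rank hd h
        rw [gPoly, reflect_one_add_C_mul_X (by omega)]
    rw [h1, ← t.2.sum_eq hd hdn, ← finsum_mem_coe_finset]
    refine finsum_mem_eq_of_bijOn Subtype.val ⟨?_, Subtype.val_injective.injOn, ?_⟩ fun _ _ => rfl
    · intro u hu
      simp only [Finset.coe_filter, Set.mem_ofPred_eq, mem_flats]
      exact ⟨u.2, hu⟩
    · intro u hu
      simp only [Finset.coe_filter, Set.mem_ofPred_eq, mem_flats] at hu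
      exact ⟨⟨u, hu.1⟩, hu.2, rfl⟩

/-- Multiplexes are self-dual. -/
def flatsDual (d n : ℕ) :
    {V : Finset ℕ // IsFlat d n V}ᵒᵈ ≃o {V : Finset ℕ // IsFlat d n V} where
  toFun V := ⟨nbr d n (OrderDual.ofDual V).1, (OrderDual.ofDual V).2.nbr⟩
  invFun V := OrderDual.toDual ⟨nbr d n V.1, V.2.nbr⟩
  left_inv V := by
    apply OrderDual.ofDual.injective
    exact Subtype.ext (OrderDual.ofDual V).2
  right_inv V := Subtype.ext V.2
  map_rel_iff' {U V} := (OrderDual.ofDual U).2.nbr_subset_nbr_iff (OrderDual.ofDual V).2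

end Multiplex

/-! ### Faces of a polytope as intersections of facets -/

section Polytope

variable {E ι : Type*} [NormedAddCommGroup E] [NormedSpace ℝ E] [Finite ι] {x : ι → E}

theorem IsExposed.eq_convexHull_image {F : Set E}
    (hF : IsExposed ℝ (convexHull ℝ (Set.range x)) F) : F = convexHull ℝ (x '' {i | x i ∈ F}) := by
  have hK : IsCompact (convexHull ℝ (Set.range x)) := (Set.finite_range x).isCompact_convexHull ℝ
  have hconv := hF.convex (convex_convexHull ℝ _)
  apply Set.Subset.antisymm
  · conv_lhs => rw [← closure_convexHull_extremePoints (hF.isCompact hK) hconv]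
    refine closure_minimal (convexHull_mono ?_)
      (((Set.toFinite _).image x).isCompact_convexHull ℝ).isClosed
    intro y hy
    have hyF : y ∈ F := hy.1
    rw [hF.isExtreme.extremePoints_eq] at hy
    obtain ⟨i, rfl⟩ := extremePoints_convexHull_subset hy.2
    exact ⟨i, hyF, rfl⟩
  · refine convexHull_min ?_ hconv
    rintro _ ⟨i, hi, rfl⟩
    exact hi

variable [FiniteDimensional ℝ E]

/-- If the vertices on a supporting hyperplane do not span a facet, then the hyperplane can be
turned until it touches a further vertex, away from a given vertex. -/
theorem exists_supporting_of_finrank_lt (hx : affineSpan ℝ (Set.range x) = ⊤)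
    {l : StrongDual ℝ E} {c : ℝ} (hl : ∀ i, l (x i) ≤ c) {j i₀ : ι} (hj : l (x j) < c)
    (hi₀ : l (x i₀) = c)
    (hrank : Module.finrank ℝ (vectorSpan ℝ (x '' {i | l (x i) = c})) + 1 < Module.finrank ℝ E) :
    ∃ (l' : StrongDual ℝ E) (c' : ℝ), (∀ i, l' (x i) ≤ c') ∧ l' (x j) < c' ∧
      {i | l (x i) = c} ⊂ {i | l' (x i) = c'} := by
  set D := vectorSpan ℝ (x '' {i | l (x i) = c}) with hD
  -- A functional that kills this subspace is constant on the face and takes the same value at x j,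
  -- so adding multiples of it preserves the gap at x j.
  have hlt : D ⊔ ℝ ∙ (x j - x i₀) < ⊤ := by
    refine lt_top_iff_ne_top.2 fun h => ?_
    have h1 := Submodule.finrank_add_le_finrank_add_finrank D (ℝ ∙ (x j - x i₀))
    have h2 := finrank_span_le_card (R := ℝ) {x j - x i₀}
    rw [Set.toFinset_singleton, Finset.card_singleton] at h2
    rw [h, finrank_top] at h1
    omega
  obtain ⟨g₀, hg₀, hker⟩ := Submodule.exists_le_ker_of_lt_top _ hlt
  have hdir : vectorSpan ℝ (Set.range x) = ⊤ := by
    rw [← direction_affineSpan, hx, AffineSubspace.direction_top]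
  obtain ⟨g, hgs, hgj, i₁, hi₁⟩ : ∃ g : StrongDual ℝ E, (∀ i, l (x i) = c → g (x i) = g (x i₀)) ∧
      g (x j) = g (x i₀) ∧ ∃ i, g (x i₀) < g (x i) := by
    have hs : ∀ i, l (x i) = c → g₀ (x i) = g₀ (x i₀) := fun i hi => by
      have : x i - x i₀ ∈ D := vsub_mem_vectorSpan ℝ (Set.mem_image_of_mem x hi)
        (Set.mem_image_of_mem x hi₀)
      have := hker (Submodule.mem_sup_left this)
      rw [LinearMap.mem_ker, map_sub, sub_eq_zero] at this
      exact this
    have hj' : g₀ (x j) = g₀ (x i₀) := by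
      have := hker (Submodule.mem_sup_right (Submodule.mem_span_singleton_self (x j - x i₀)))
      rw [LinearMap.mem_ker, map_sub, sub_eq_zero] at this
      exact this
    obtain ⟨i, hi⟩ : ∃ i, g₀ (x i) ≠ g₀ (x i₀) := by
      by_contra! hall
      apply hg₀
      have : vectorSpan ℝ (Set.range x) ≤ LinearMap.ker g₀ := by
        rw [vectorSpan_def, Submodule.span_le]
        rintro _ ⟨_, ⟨a, rfl⟩, _, ⟨b, rfl⟩, rfl⟩
        simp [hall a, hall b]
      rw [hdir, top_le_iff, LinearMap.ker_eq_top] at this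
      exact this
    rcases lt_or_gt_of_ne hi with hi | hi
    · exact ⟨LinearMap.toContinuousLinearMap (-g₀), fun i hi => by simp [hs i hi], by simp [hj'],
        i, by simpa using hi⟩
    · exact ⟨LinearMap.toContinuousLinearMap g₀, fun i hi => by simp [hs i hi], by simp [hj'],
        i, by simpa using hi⟩
  -- `i₂` is a first vertex met when the hyperplane turns in the direction g; the minimal ratio
  -- keeps the other vertices on the correct side.
  obtain ⟨i₂, hi₂, hmin⟩ := (Set.toFinite {i | g (x i₀) < g (x i)}).exists_minimalFor
    (fun i => (c - l (x i)) / (g (x i) - g (x i₀))) _ ⟨i₁, hi₁⟩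
  set s := (c - l (x i₂)) / (g (x i₂) - g (x i₀)) with hs
  have hs0 : 0 ≤ s := div_nonneg (sub_nonneg.2 (hl i₂)) (sub_nonneg.2 (le_of_lt hi₂))
  refine ⟨l + s • g, c + s * g (x i₀), fun i => ?_, ?_, ?_⟩
  · simp only [add_apply, smul_apply, smul_eq_mul]
    rcases le_or_gt (g (x i)) (g (x i₀)) with h | h
    · have := mul_le_mul_of_nonneg_left h hs0
      linarith [hl i]
    · have h1 : s ≤ (c - l (x i)) / (g (x i) - g (x i₀)) := by
        rcases le_total s ((c - l (x i)) / (g (x i) - g (x i₀))) with h2 | h2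
        · exact h2
        · exact hmin h h2
      rw [le_div_iff₀ (sub_pos.2 h)] at h1
      linarith
  · simp only [add_apply, smul_apply, smul_eq_mul, hgj]
    linarith
  · rw [Set.ssubset_iff_of_subset]
    · refine ⟨i₂, ?_, fun h => ?_⟩
      · have : s * (g (x i₂) - g (x i₀)) = c - l (x i₂) :=
          div_mul_cancel₀ _ (sub_pos.2 hi₂).ne'
        simp only [Set.mem_ofPred_eq, add_apply,
          smul_apply, smul_eq_mul]
        linarith
      · exact (hgs i₂ h ▸ hi₂ : g (x i₀) < g (x i₀)).false
    · intro i hi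
      have h1 : l (x i) = c := hi
      simp only [Set.mem_ofPred_eq, add_apply,
        smul_apply, smul_eq_mul, hgs i h1, h1]

/-- A face of a full-dimensional polytope and a vertex off the face are separated by a facet. -/
theorem IsExposed.exists_isFacet (hx : affineSpan ℝ (Set.range x) = ⊤) {F : Set E}
    (hF : IsExposed ℝ (convexHull ℝ (Set.range x)) F) (hne : F.Nonempty) {j : ι} (hj : x j ∉ F) :
    ∃ G, IsFacet (convexHull ℝ (Set.range x)) G ∧ F ⊆ G ∧ x j ∉ G := by
  have hmemK : ∀ i, x i ∈ convexHull ℝ (Set.range x) := fun i =>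
    subset_convexHull ℝ _ (Set.mem_range_self i)
  have hdir : vectorSpan ℝ (convexHull ℝ (Set.range x)) = ⊤ := by
    rw [← direction_affineSpan, affineSpan_convexHull, hx, AffineSubspace.direction_top]
  have hhull : ∀ (l : StrongDual ℝ E) (c : ℝ), (∀ i, l (x i) ≤ c) →
      ∀ y ∈ convexHull ℝ (Set.range x), l y ≤ c := fun l c hl y hy => by
    have : convexHull ℝ (Set.range x) ⊆ {y | l y ≤ c} :=
      convexHull_min (by rintro _ ⟨i, rfl⟩; exact hl i) (convex_halfSpace_le l.isLinear c)
    exact this hy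
  obtain ⟨i₀, hi₀⟩ : ∃ i, x i ∈ F := by
    by_contra! h
    have h1 := hF.eq_convexHull_image
    have h2 : {i | x i ∈ F} = ∅ := Set.eq_empty_of_forall_notMem h
    rw [h2, Set.image_empty, convexHull_empty] at h1
    exact hne.ne_empty h1
  obtain ⟨l₀, hl₀⟩ := hF hne
  have hle₀ : ∀ i, l₀ (x i) ≤ l₀ (x i₀) := by
    rw [hl₀] at hi₀
    exact fun i => hi₀.2 _ (hmemK i)
  -- These are the vertex sets of supporting hyperplanes that contain `F` and miss x j. A maximal
  -- one spans a facet, since otherwise its hyperplane could be turned further.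
  let 𝒮 : Set (Set ι) := {s | ∃ (l : StrongDual ℝ E) (c : ℝ), (∀ i, l (x i) ≤ c) ∧ l (x j) < c ∧
    s = {i | l (x i) = c} ∧ {i | x i ∈ F} ⊆ s}
  have hne' : 𝒮.Nonempty := by
    refine ⟨_, l₀, l₀ (x i₀), hle₀, ?_, rfl, fun i hi => ?_⟩
    · refine lt_of_le_of_ne (hle₀ j) fun h => hj ?_
      rw [hl₀]
      refine ⟨hmemK j, fun y hy => ?_⟩
      rw [h]
      exact hhull l₀ _ hle₀ y hy
    · have hi' : x i ∈ F := hi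
      rw [hl₀] at hi'
      exact le_antisymm (hle₀ i) (hi'.2 _ (hmemK i₀))
  obtain ⟨s, hs⟩ := (Set.toFinite 𝒮).exists_maximal hne'
  obtain ⟨l, c, hl, hlj, rfl, hFs⟩ := hs.1
  have hli₀ : l (x i₀) = c := hFs hi₀
  set G : Set E := {y ∈ convexHull ℝ (Set.range x) | ∀ z ∈ convexHull ℝ (Set.range x), l z ≤ l y}
    with hG
  have hGe : IsExposed ℝ (convexHull ℝ (Set.range x)) G := fun _ => ⟨l, rfl⟩
  have hmemG : ∀ i, x i ∈ G ↔ l (x i) = c := by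
    intro i
    constructor
    · intro h
      exact le_antisymm (hl i) (hli₀ ▸ h.2 _ (hmemK i₀))
    · intro h
      refine ⟨hmemK i, fun z hz => ?_⟩
      rw [h]
      exact hhull l c hl z hz
  have hGeq := hGe.eq_convexHull_image
  simp only [hmemG] at hGeq
  refine ⟨G, ⟨hGe, ⟨x i₀, (hmemG i₀).2 hli₀⟩, ?_⟩, ?_, fun h => hlj.ne ((hmemG j).1 h)⟩
  · rw [hdir, finrank_top]
    have hvs : vectorSpan ℝ G = vectorSpan ℝ (x '' {i | l (x i) = c}) := by
      rw [hGeq, ← direction_affineSpan, affineSpan_convexHull, direction_affineSpan]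
    rw [hvs]
    apply le_antisymm
    · have hlt : vectorSpan ℝ (x '' {i | l (x i) = c}) < ⊤ := by
        refine lt_of_le_of_lt (b := LinearMap.ker (l : E →ₗ[ℝ] ℝ)) ?_ ?_
        · rw [vectorSpan_def, Submodule.span_le]
          rintro _ ⟨_, ⟨a, ha, rfl⟩, _, ⟨b, hb, rfl⟩, rfl⟩
          have ha' : l (x a) = c := ha
          have hb' : l (x b) = c := hb
          simp [ha', hb']
        · refine lt_top_iff_ne_top.2 fun h => ?_
          have h1 : x j - x i₀ ∈ LinearMap.ker (l : E →ₗ[ℝ] ℝ) := h ▸ Submodule.mem_top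
          simp [sub_eq_zero, hli₀] at h1
          exact hlj.ne h1
      have := Submodule.finrank_lt_finrank_of_lt hlt
      rw [finrank_top] at this
      omega
    · by_contra! hlt
      obtain ⟨l', c', h1, h2, h3⟩ := exists_supporting_of_finrank_lt hx hl hlj hli₀ hlt
      exact hs.not_gt ⟨l', c', h1, h2, rfl, hFs.trans h3.subset⟩ h3
  · rw [hF.eq_convexHull_image]
    refine convexHull_min ?_ (hGe.convex (convex_convexHull ℝ _))
    rintro _ ⟨i, hi, rfl⟩
    exact (hmemG i).2 (hFs hi)

end Polytope

/-! ### The face lattice of a multiplex -/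

theorem mem_multiplexFacet_iff {d n : ℕ} (hd : 2 ≤ d) (i j : Fin (n + 1)) :
    j ∈ multiplexFacet d n i ↔ Multiplex.Rel d n i j := by
  have hi := i.2
  have hj := j.2
  unfold Multiplex.Rel
  constructor
  · rintro ⟨k, h1, h2, h3⟩
    rcases abs_cases k with ⟨hk, _⟩ | ⟨hk, _⟩ <;> rw [hk] at h1 h2 <;> omega
  · rintro (⟨h1, h2 | h2⟩ | ⟨h1, h2, h3⟩)
    -- Clamping sends -1 to 0 and n + 1 to n, so the facets 0 and n contain the vertices of their
    -- own index.
    · exact ⟨-1, by simp, by simp; omega, by omega⟩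
    · exact ⟨1, by simp, by simp; omega, by omega⟩
    · refine ⟨(j : ℤ) - i, ?_, ?_, by omega⟩ <;>
        rcases abs_cases ((j : ℤ) - i) with ⟨hk, _⟩ | ⟨hk, _⟩ <;> rw [hk] <;> omega

namespace IsMultiplex

variable {d n : ℕ} {x : Fin (n + 1) → EuclideanSpace ℝ (Fin d)}

open Classical in
/-- The indices of the vertices in `F`. -/
noncomputable def verts (x : Fin (n + 1) → EuclideanSpace ℝ (Fin d))
    (F : Set (EuclideanSpace ℝ (Fin d))) : Finset ℕ :=
  ({i | x i ∈ F} : Finset (Fin (n + 1))).image Fin.val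

theorem mem_verts {F : Set (EuclideanSpace ℝ (Fin d))} {i : Fin (n + 1)} :
    (i : ℕ) ∈ verts x F ↔ x i ∈ F := by
  simp [verts, Fin.val_inj]

theorem verts_subset_range (F : Set (EuclideanSpace ℝ (Fin d))) :
    verts x F ⊆ Finset.range (n + 1) := by
  intro k hk
  obtain ⟨i, -, rfl⟩ := Finset.mem_image.1 hk
  exact Finset.mem_range.2 i.2

theorem verts_mono {F G : Set (EuclideanSpace ℝ (Fin d))} (h : F ⊆ G) :
    verts x F ⊆ verts x G := by
  intro k hk
  obtain ⟨i, rfl⟩ : ∃ i : Fin (n + 1), ↑i = k :=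
    ⟨⟨k, Finset.mem_range.1 (verts_subset_range F hk)⟩, rfl⟩
  rw [mem_verts] at hk ⊢
  exact h hk

theorem subset_of_verts_subset {F G : Set (EuclideanSpace ℝ (Fin d))}
    (hF : IsExposed ℝ (convexHull ℝ (Set.range x)) F)
    (hG : IsExposed ℝ (convexHull ℝ (Set.range x)) G) (h : verts x F ⊆ verts x G) : F ⊆ G := by
  rw [hF.eq_convexHull_image, hG.eq_convexHull_image]
  refine convexHull_mono (Set.image_mono fun i hi => ?_)
  exact mem_verts.1 (h (mem_verts.2 hi))

theorem verts_convexHull_range : verts x (convexHull ℝ (Set.range x)) = Finset.range (n + 1) := by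
  refine Finset.Subset.antisymm (verts_subset_range _) fun k hk => ?_
  obtain ⟨i, rfl⟩ : ∃ i : Fin (n + 1), ↑i = k := ⟨⟨k, Finset.mem_range.1 hk⟩, rfl⟩
  exact mem_verts.2 (subset_convexHull ℝ _ (Set.mem_range_self i))

theorem mem_facet_iff (hx : IsMultiplex d n x) (hd : 2 ≤ d) (i j : Fin (n + 1)) :
    x j ∈ convexHull ℝ (x '' multiplexFacet d n i) ↔ Multiplex.Rel d n i j := by
  rw [hx.convexIndependent.mem_convexHull_iff, mem_multiplexFacet_iff hd]

theorem isFlat_verts (hx : IsMultiplex d n x) (hd : 2 ≤ d) (hdn : d ≤ n)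
    {F : Set (EuclideanSpace ℝ (Fin d))} (hF : IsExposed ℝ (convexHull ℝ (Set.range x)) F) :
    Multiplex.IsFlat d n (verts x F) := by
  rcases F.eq_empty_or_nonempty with rfl | hne
  · convert Multiplex.isFlat_empty (by omega) hdn
    simp [verts]
  · rw [Multiplex.isFlat_iff (verts_subset_range _)]
    intro k hk hkF
    obtain ⟨j, rfl⟩ : ∃ i : Fin (n + 1), ↑i = k := ⟨⟨k, by omega⟩, rfl⟩
    rw [mem_verts] at hkF
    obtain ⟨G, hG, hFG, hjG⟩ := hF.exists_isFacet hx.affineSpan_eq_top hne hkF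
    obtain ⟨i, rfl⟩ := (hx.facets G).1 hG
    rw [hx.mem_facet_iff hd] at hjG
    refine ⟨i, by omega, fun k hk => ?_, hjG⟩
    obtain ⟨j', rfl⟩ : ∃ i : Fin (n + 1), ↑i = k :=
      ⟨⟨k, Finset.mem_range.1 (verts_subset_range F hk)⟩, rfl⟩
    exact (hx.mem_facet_iff hd i j').1 (hFG (mem_verts.1 hk))

/-- Closed sets are the vertex sets of intersections of facets, and finite intersections of exposed
faces are exposed; the empty intersection is the whole polytope. -/
theorem exists_isExposed (hx : IsMultiplex d n x) (hd : 2 ≤ d) {V : Finset ℕ}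
    (hV : Multiplex.IsFlat d n V) :
    ∃ F, IsExposed ℝ (convexHull ℝ (Set.range x)) F ∧ verts x F = V := by
  have hfacet : ∀ i, IsExposed ℝ (convexHull ℝ (Set.range x))
      (convexHull ℝ (x '' multiplexFacet d n i)) := fun i => ((hx.facets _).2 ⟨i, rfl⟩).1
  suffices h : ∀ S ⊆ Finset.range (n + 1), ∃ F, IsExposed ℝ (convexHull ℝ (Set.range x)) F ∧
      verts x F = Multiplex.nbr d n S by
    obtain ⟨F, hF, hFV⟩ := h _ hV.nbr.subset_range
    exact ⟨F, hF, hFV.trans hV⟩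
  intro S hS
  induction S using Finset.induction_on with
  | empty =>
    refine ⟨_, IsExposed.refl _, ?_⟩
    rw [verts_convexHull_range]
    simp [Multiplex.nbr]
  | insert k S _ ih =>
    obtain ⟨F, hF, hFS⟩ := ih ((Finset.subset_insert _ _).trans hS)
    obtain ⟨i, rfl⟩ : ∃ i : Fin (n + 1), ↑i = k :=
      ⟨⟨k, Finset.mem_range.1 (hS (Finset.mem_insert_self _ _))⟩, rfl⟩
    refine ⟨_, hF.inter (hfacet i), ?_⟩
    ext k
    by_cases hk : k < n + 1
    · obtain ⟨j, rfl⟩ : ∃ i : Fin (n + 1), ↑i = k := ⟨⟨k, hk⟩, rfl⟩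
      have h1 : x j ∈ F ↔ (j : ℕ) ∈ Multiplex.nbr d n S := by rw [← hFS, mem_verts]
      rw [mem_verts, Set.mem_inter_iff, h1, hx.mem_facet_iff hd, Multiplex.mem_nbr,
        Multiplex.mem_nbr, Finset.forall_mem_insert]
      tauto
    · refine iff_of_false (fun h => hk ?_) (fun h => hk ?_)
      · exact Finset.mem_range.1 (verts_subset_range _ h)
      · exact Finset.mem_range.1 (Multiplex.nbr_subset_range _ h)

/-- The face of a multiplex that belongs to an element of its face lattice. -/
def face (y : WithTop (BoundaryPoset (convexHull ℝ (Set.range x)))) :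
    Set (EuclideanSpace ℝ (Fin d)) :=
  y.recTopCoe (convexHull ℝ (Set.range x)) Subtype.val

theorem isExposed_face (y : WithTop (BoundaryPoset (convexHull ℝ (Set.range x)))) :
    IsExposed ℝ (convexHull ℝ (Set.range x)) (face y) := by
  induction y using WithTop.recTopCoe with
  | top => exact IsExposed.refl _
  | coe F => exact F.2.1

theorem face_subset_face {y z : WithTop (BoundaryPoset (convexHull ℝ (Set.range x)))} :
    face y ⊆ face z ↔ y ≤ z := by
  induction z using WithTop.recTopCoe with
  | top => exact iff_of_true (isExposed_face y).subset le_top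
  | coe G =>
    induction y using WithTop.recTopCoe with
    | top =>
      refine iff_of_false (fun h => G.2.2 (Set.Subset.antisymm G.2.1.subset h)) ?_
      simp
    | coe F => exact (WithTop.coe_le_coe (a := G) (b := F)).symm

/-- The face lattice of a multiplex is the lattice of closed sets of its vertex-facet
incidences. -/
noncomputable def faceLatticeEmbedding (hx : IsMultiplex d n x) (hd : 2 ≤ d) (hdn : d ≤ n) :
    WithTop (BoundaryPoset (convexHull ℝ (Set.range x))) ↪o
      {V : Finset ℕ // Multiplex.IsFlat d n V} :=
  OrderEmbedding.ofMapLEIff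
    (fun y => ⟨verts x (face y), hx.isFlat_verts hd hdn (isExposed_face y)⟩) fun y z => by
      rw [← face_subset_face]
      exact ⟨subset_of_verts_subset (isExposed_face y) (isExposed_face z), verts_mono⟩

theorem faceLatticeEmbedding_surjective (hx : IsMultiplex d n x) (hd : 2 ≤ d) (hdn : d ≤ n) :
    Function.Surjective (hx.faceLatticeEmbedding hd hdn) := by
  rintro ⟨V, hV⟩
  obtain ⟨F, hF, rfl⟩ := hx.exists_isExposed hd hV
  by_cases h : F = convexHull ℝ (Set.range x)
  · subst h
    exact ⟨⊤, rfl⟩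
  · exact ⟨((⟨F, hF, h⟩ : BoundaryPoset (convexHull ℝ (Set.range x))) : WithTop _), rfl⟩

/-- The order isomorphism of the face lattice with the lattice of closed sets. -/
noncomputable def faceLatticeIso (hx : IsMultiplex d n x) (hd : 2 ≤ d) (hdn : d ≤ n) :
    WithTop (BoundaryPoset (convexHull ℝ (Set.range x))) ≃o
      {V : Finset ℕ // Multiplex.IsFlat d n V} :=
  RelIso.ofSurjective (hx.faceLatticeEmbedding hd hdn)
    (hx.faceLatticeEmbedding_surjective hd hdn)

end IsMultiplex

/-! ### Truncation and conclusion -/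

theorem IsToricData.comap_iso {P Q : Type*} [PartialOrder P] [PartialOrder Q] {ρ : P → ℕ}
    {γ : P → ℤ[X]} (h : IsToricData ρ γ) (e : Q ≃o P) : IsToricData (ρ ∘ e) (γ ∘ e) :=
  h.comap e.toOrderEmbedding (by
    have : Set.range e.toOrderEmbedding = Set.univ := e.surjective.range_eq
    rw [this]
    exact isLowerSet_univ)

/-- The truncation of `f` when the two intervals at `t` have linear `g`-polynomials. -/
theorem gTrunc_eq_of_linear {d k : ℕ} {a b : ℤ} {f : ℤ[X]} (hk : d / 2 + 1 < k)
    (hd : d - k + 2 ≤ d / 2)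
    (hf : (1 - X) * f = (1 + C b * X) * (X ^ (d - k + 1) + C a * X ^ (d - k)) -
      (1 + C a * X) * (X ^ k + C b * X ^ (k - 1))) :
    gTrunc d f = C a * X ^ (d - k) + C (b * a + 1) * X ^ (d - k + 1) +
      C b * X ^ (d - k + 2) := by
  -- The subtracted trinomial is the reversal of the kept one in degree d + 1; it starts at k - 1 >
  -- d/2.
  refine gTrunc_eq_of_mul_eq d f _ (C b * X ^ (k - 1) + C (a * b + 1) * X ^ k +
    C a * X ^ (k + 1)) ?_ ?_ ?_
  · obtain ⟨k, rfl⟩ : ∃ l, k = l + 1 := ⟨k - 1, by omega⟩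
    rw [hf, Nat.add_sub_cancel]
    simp only [C_add, C_mul, C_1]
    ring
  · intro i hi
    simp only [coeff_add, coeff_C_mul_X_pow]
    rw [if_neg (by omega), if_neg (by omega), if_neg (by omega)]
    simp
  · intro i hi
    simp only [coeff_add, coeff_C_mul_X_pow]
    rw [if_neg (by omega), if_neg (by omega), if_neg (by omega)]
    simp

theorem coeff_nonneg_of_linear {m : ℕ} {a b : ℤ} (ha : 0 ≤ a) (hb : 0 ≤ b) (k : ℕ) :
    0 ≤ (C a * X ^ m + C (b * a + 1) * X ^ (m + 1) + C b * X ^ (m + 2) : ℤ[X]).coeff k := by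
  simp only [coeff_add, coeff_C_mul_X_pow]
  have : 0 ≤ b * a := mul_nonneg hb ha
  split_ifs <;> omega

theorem Multiplex.coeff_one_gPoly (d : ℕ) (V : Finset ℕ) :
    (Multiplex.gPoly d V).coeff 1 = Multiplex.excess d V := by
  rw [Multiplex.gPoly, coeff_add, coeff_C_mul, coeff_X_one, mul_one, coeff_one]
  simp

theorem lemma3p2 (d n : ℕ) (hd : 4 ≤ d) (hdn : d ≤ n)
    (x : Fin (n + 1) → EuclideanSpace ℝ (Fin d)) (hx : IsMultiplex d n x)
    (I : Set (BoundaryPoset (convexHull ℝ (Set.range x)))) (hI : IsLowerSet I)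
    (t : BoundaryPoset (convexHull ℝ (Set.range x))) (ht : Maximal (· ∈ I) t) :
    let M := BoundaryPoset (convexHull ℝ (Set.range x))
    let Δg : ℤ[X] := toricG (Bier M (I \ {t})) - toricG (Bier M I)
    let gA : ℤ := (toricG (Set.Ioi (t : WithTop M))ᵒᵈ).coeff 1
    let gB : ℤ := (toricG (Set.Iio t)).coeff 1
    (⌈(d : ℚ) / 2⌉₊ + 1 < elemRank t → elemRank t < d →
      Δg = C gA * X ^ (d - elemRank t) + C (gB * gA + 1) * X ^ (d - elemRank t + 1)
          + C gB * X ^ (d - elemRank t + 2) ∧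
        ∀ k, 0 ≤ Δg.coeff k) ∧
    (elemRank t = d →
      Δg = X + C gB * X ^ 2 ∧ ∀ k, 0 ≤ Δg.coeff k) := by
  intro M Δg gA gB
  have hd2 : 2 ≤ d := by omega
  have hdata := Multiplex.isToricData hd2 hdn
  let e := hx.faceLatticeIso hd2 hdn
  -- In the opposite lattice a face is represented by the facets through it, so the interval above t
  -- is measured by `nbr` of its vertex set.
  let e' := e.dual.trans (Multiplex.flatsDual d n)
  have h := hdata.comap_iso e
  have h' := hdata.comap_iso e'
  set V : {V : Finset ℕ // Multiplex.IsFlat d n V} := e (t : WithTop M) with hV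
  have hsum : ∀ y : WithTop M, Multiplex.rank d (e y).1 +
      Multiplex.rank d (e' (OrderDual.toDual y)).1 = d + 1 := fun y =>
    (e y).2.rank_add_rank_nbr (by omega) hdn
  have hM := h.comap (WithTop.coeOrderHom : M ↪o WithTop M) (by
    rintro a b hba ⟨c, rfl⟩
    obtain ⟨b', rfl, -⟩ := WithTop.le_coe_iff.1 hba
    exact ⟨b', rfl⟩)
  have hrank : elemRank t = Multiplex.rank d V.1 := hM.elemRank_eq t
  have hgB : gB = Multiplex.excess d V.1 := by
    rw [← Multiplex.coeff_one_gPoly]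
    exact congrArg (fun p => coeff p 1) (hM.toricG_Iio t)
  have hgA : gA = Multiplex.excess d (Multiplex.nbr d n V.1) := by
    rw [← Multiplex.coeff_one_gPoly]
    refine congrArg (fun p => coeff p 1) (h'.toricG_eq_of_range (t := OrderDual.toDual (t : WithTop M))
      (OrderEmbedding.subtype (· ∈ Set.Ioi (t : WithTop M))).dual ?_)
    ext y
    constructor
    · rintro ⟨z, rfl⟩
      exact (OrderDual.ofDual z).2
    · intro hy
      exact ⟨OrderDual.toDual ⟨OrderDual.ofDual y, hy⟩, rfl⟩
  have hgA0 : 0 ≤ gA := by rw [hgA]; positivity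
  have hgB0 : 0 ≤ gB := by rw [hgB]; positivity
  have hk := V.2.rank_add_rank_nbr (by omega) hdn
  have key : ∀ k, elemRank t = k → k ≤ d → d / 2 + 1 < k → d - k + 2 ≤ d / 2 →
      Δg = C gA * X ^ (d - k) + C (gB * gA + 1) * X ^ (d - k + 1) + C gB * X ^ (d - k + 2) := by
    intro k hkt hkd h1 h2
    rw [hrank] at hkt
    obtain ⟨f, hf, hf'⟩ := h.toricG_bier_diff h' hsum hI ht (by
      change Multiplex.rank d V.1 ≠ 0
      omega)
    refine hf.trans (gTrunc_eq_of_linear h1 h2 (hf'.trans ?_))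
    change Multiplex.gPoly d V.1 * reflect (Multiplex.rank d (Multiplex.nbr d n V.1))
      (Multiplex.gPoly d (Multiplex.nbr d n V.1)) - Multiplex.gPoly d (Multiplex.nbr d n V.1) *
      reflect (Multiplex.rank d V.1) (Multiplex.gPoly d V.1) = _
    rw [Multiplex.gPoly, Multiplex.gPoly, Multiplex.reflect_one_add_C_mul_X (by omega),
      Multiplex.reflect_one_add_C_mul_X (by omega), ← hgA, ← hgB, hkt,
      show Multiplex.rank d (Multiplex.nbr d n V.1) = d - k + 1 by omega, Nat.add_sub_cancel]
  refine ⟨fun h1 h2 => ?_, fun h1 => ?_⟩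
  · have h3 : d ≤ 2 * ⌈(d : ℚ) / 2⌉₊ := by
      have := Nat.le_ceil ((d : ℚ) / 2)
      have : (d : ℚ) ≤ 2 * (⌈(d : ℚ) / 2⌉₊ : ℚ) := by linarith
      exact_mod_cast this
    have h4 := key _ rfl h2.le (by omega) (by omega)
    exact ⟨h4, fun k => h4 ▸ coeff_nonneg_of_linear hgA0 hgB0 k⟩
  -- The dual face of a facet has rank 1, and a nonzero excess needs rank at least 3.
  · have hA : gA = 0 := by
      rw [hgA, Nat.cast_eq_zero]
      by_contra h0
      have := V.2.nbr.three_le_rank hd2 h0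
      omega
    -- Here d ≥ 4 is what keeps x² within the truncation and x^(d-1) outside it.
    have h4 := key d h1 le_rfl (by omega) (by omega)
    have h5 : Δg = X + C gB * X ^ 2 := by
      rw [h4, hA]
      simp
    refine ⟨h5, fun k => ?_⟩
    rw [h4]
    exact coeff_nonneg_of_linear hgA0 hgB0 k
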